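/- **Theorem 3 (revenue comparison when exactly one supplier has storage).** *Market.* Two suppliers $i\in\{1,2\}$ (the competitor of $i$ is $-i$) compete for a demand $D>0$. Supplier $i$'s random generation $X_i$ takes values in $[0,\bar X_i]$ and has a continuous distribution function $F_i$. Prices lie in $[0,\bar p]$, where $0<\bar p<P_g$ ($P_g$ is the price of the main grid), and the unit penalty price satisfies $\lambda>\bar p$. Let $\varphi_i=1$ if supplier $i$ has storage and $\varphi_i=0$ otherwise. Supplier $i$, selling the quantity $x$ at the price $p$, has the revenue $$\pi_i^R(p,x)=\begin{cases}p x-\lambda\,(x-\mathbb E[X_i])^+,&\varphi_i=1,\\ p x-\lambda\,\mathbb E[(x-X_i)^+],&\varphi_i=0.\end{cases}$$ At the price $p_i$ supplier $i$ bids the weakly dominant quantity $y_i^*(p_i)=\mathbb E[X_i]$ if $\varphi_i=1$, and $y_i^*(p_i)=F_i^{-1}(p_i/\lambda)$ if $\varphi_i=0$, where $F_i^{-1}(q)=\inf\{x\ge 0: F_i(x)\ge q\}$. Consumers maximize their savings $\sum_i (P_g-p_i)x_i$ subject to $x_1+x_2\le D$ and $0\le x_i\le y_i^*(p_i)$, that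 is, they serve the cheaper supplier first: if $i$ is served first, $x_i=\min(D,y_i^*(p_i))$ and $x_{-i}=\min(D-x_i,\,y_{-i}^*(p_{-i}))$. If $p_1=p_2$, they choose the order of service with the larger total revenue of the two suppliers, and toss a fair coin if the two totals agree. In the resulting price game each supplier's payoff is his (expected) revenue. A pure price equilibrium is a pair of prices in $[0,\bar p]$, and a mixed price equilibrium a pair of independent probability measures on $[0,\bar p]$, from which no supplier can increase his (expected) revenue by a unilateral deviation; $\pi_i^{RE}$ denotes the (expected) revenue of supplier $i$ at the equilibrium. *Statement.* Let $\varphi_i=1$, $\varphi_{-i}=0$ and $\mathbb E[X_i]=\mathbb E[X_{-i}]$, and suppose that $F_{-i}(x)>0$ for all $x>0$. Then at every pure and at every mixed price equilibrium $$\pi_i^{RE}>\pi_{-i}^{RE}.$$ If moreover $X_{-i}$ is uniformly distributed on $[0,\bar X_{-i}]$, then at every such equilibrium $\pi_{-i}^{RE}>0$ and $$\frac{\pi_i^{RE}}{\pi_{-i}^{RE}}\ \ge\ \begin{cases}2,&\text{if } 0<D\le \mathbb E[X_i],\\ 4,&\text{if } D=\mathbb E[X_i],\\ \lambda/\bar p,&\text{if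 } D>\mathbb E[X_i].\end{cases}$$ -/

import Mathlib

open MeasureTheory Set

noncomputable section

/-- The data of one hour of the local energy market with two suppliers, indexed by `Fin 2`
(the competitor of supplier `i` is `1 - i`). -/
structure Market (Ω : Type*) [MeasurableSpace Ω] where
  /-- probability on the sample space -/
  P : Measure Ω
  /-- random renewable generations -/
  X : Fin 2 → Ω → ℝ
  /-- maximal generations -/
  Xbar : Fin 2 → ℝ
  /-- consumers' demand -/
  D : ℝ
  /-- price cap -/
  pbar : ℝ
  /-- unit penalty price for a shortfall -/
  lam : ℝ
  /-- price of the main grid -/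
  Pg : ℝ

namespace Market

variable {Ω : Type*} [MeasurableSpace Ω]

/-- The cumulative distribution function of the generation of supplier `i`. -/
def genCDF (M : Market Ω) (i : Fin 2) (x : ℝ) : ℝ := M.P.real {ω | M.X i ω ≤ x}

/-- The mean generation of supplier `i`. -/
def mean (M : Market Ω) (i : Fin 2) : ℝ := ∫ ω, M.X i ω ∂M.P

/-- The standing assumptions on the market. -/
structure Admissible (M : Market Ω) : Prop where
  prob : IsProbabilityMeasure M.P
  meas : ∀ i, Measurable (M.X i)
  bounded : ∀ i, ∀ᵐ ω ∂M.P, M.X i ω ∈ Icc 0 (M.Xbar i)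
  cdf_cont : ∀ i, Continuous (M.genCDF i)
  demand_pos : 0 < M.D
  cap_pos : 0 < M.pbar
  cap_lt_grid : M.pbar < M.Pg
  cap_lt_penalty : M.pbar < M.lam

/-! ### Consumers' purchase -/

/-- The constraints of the consumers' problem, given the bidding quantities `y`. -/
def FeasiblePurchase (M : Market Ω) (y x : Fin 2 → ℝ) : Prop :=
  ∑ i, x i ≤ M.D ∧ ∀ i, 0 ≤ x i ∧ x i ≤ y i

/-- The consumers' cost saving compared with buying from the main grid. -/
def saving (M : Market Ω) (p x : Fin 2 → ℝ) : ℝ := ∑ i, (M.Pg - p i) * x i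

/-- The quantities purchased from the two suppliers if supplier `k` is served first. -/
def purchaseFirst (M : Market Ω) (y : Fin 2 → ℝ) (k i : Fin 2) : ℝ :=
  if i = k then min M.D (y k) else min (M.D - min M.D (y k)) (y i)

/-- Serving the cheaper supplier first solves the consumers' problem, for equal prices in either
order, and for different prices it is the only solution. -/
theorem purchaseFirst_optimal (M : Market Ω) (hD : 0 ≤ M.D) (p y : Fin 2 → ℝ)
    (hp : ∀ i, p i < M.Pg) (hy : ∀ i, 0 ≤ y i) (k : Fin 2) (hk : p k ≤ p (1 - k)) :
    M.FeasiblePurchase y (M.purchaseFirst y k) ∧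
    (∀ x, M.FeasiblePurchase y x → M.saving p x ≤ M.saving p (M.purchaseFirst y k)) ∧
    (p k < p (1 - k) → ∀ x, M.FeasiblePurchase y x →
      M.saving p x = M.saving p (M.purchaseFirst y k) → x = M.purchaseFirst y k) := by
  have key : ∀ (D a b g c d u v : ℝ), 0 ≤ D → 0 ≤ c → 0 ≤ d → a ≤ b → b < g →
      u + v ≤ D → 0 ≤ u → u ≤ c → 0 ≤ v → v ≤ d →
      (g - a) * u + (g - b) * v ≤
        (g - a) * min D c + (g - b) * min (D - min D c) d ∧
      (a < b → (g - a) * u + (g - b) * v =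
        (g - a) * min D c + (g - b) * min (D - min D c) d →
        u = min D c ∧ v = min (D - min D c) d) := by
    intro D a b g c d u v hD hc hd hab hbg huv hu huc hv hvd
    have h1 : u ≤ min D c := le_min (by linarith) huc
    have h2 : u + v ≤ min D c + min (D - min D c) d := by
      rcases le_total (D - min D c) d with h | h
      · rw [min_eq_left h]; linarith
      · rw [min_eq_right h]; linarith
    set s := min D c
    set t := min (D - s) d
    refine ⟨by nlinarith, fun hlt he => ?_⟩
    have e1 : (b - a) * (s - u) + (g - b) * (s + t - (u + v)) = 0 := by linarith
    have n1 : 0 ≤ (b - a) * (s - u) := mul_nonneg (by linarith) (by linarith)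
    have n2 : 0 ≤ (g - b) * (s + t - (u + v)) := mul_nonneg (by linarith) (by linarith)
    have z1 : s - u = 0 :=
      (mul_eq_zero.1 (by linarith : (b - a) * (s - u) = 0)).resolve_left (by linarith)
    have z2 : s + t - (u + v) = 0 :=
      (mul_eq_zero.1 (by linarith : (g - b) * (s + t - (u + v)) = 0)).resolve_left (by linarith)
    exact ⟨by linarith, by linarith⟩
  have hs : ∀ c d : ℝ, 0 ≤ c → 0 ≤ d →
      min M.D c + min (M.D - min M.D c) d ≤ M.D ∧ 0 ≤ min (M.D - min M.D c) d := by
    intro c d hc hd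
    have := min_le_left (M.D - min M.D c) d
    have h3 := min_le_left M.D c
    exact ⟨by linarith, le_min (by linarith) hd⟩
  fin_cases k
  · simp only [FeasiblePurchase, saving, purchaseFirst, Fin.sum_univ_two, Fin.forall_fin_two] at *
    simp only [Fin.isValue, Fin.zero_eta, sub_zero, ↓reduceIte, one_ne_zero] at *
    refine ⟨⟨(hs _ _ hy.1 hy.2).1, ⟨le_min hD hy.1, min_le_right _ _⟩,
      (hs _ _ hy.1 hy.2).2, min_le_right _ _⟩, fun x hx => ?_, fun hlt x hx he => ?_⟩
    · exact (key _ _ _ _ _ _ _ _ hD hy.1 hy.2 hk hp.2 hx.1 hx.2.1.1 hx.2.1.2 hx.2.2.1 hx.2.2.2).1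
    · have := (key _ _ _ _ _ _ _ _ hD hy.1 hy.2 hk hp.2 hx.1 hx.2.1.1 hx.2.1.2 hx.2.2.1
        hx.2.2.2).2 hlt he
      funext j
      fin_cases j
      · simpa [purchaseFirst] using this.1
      · simpa [purchaseFirst] using this.2
  · simp only [FeasiblePurchase, saving, purchaseFirst, Fin.sum_univ_two, Fin.forall_fin_two] at *
    simp only [Fin.isValue, Fin.mk_one, sub_self, ↓reduceIte, zero_ne_one] at *
    refine ⟨⟨by linarith [(hs _ _ hy.2 hy.1).1], ⟨(hs _ _ hy.2 hy.1).2, min_le_right _ _⟩,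
      le_min hD hy.2, min_le_right _ _⟩, fun x hx => ?_, fun hlt x hx he => ?_⟩
    · linarith [(key _ _ _ _ _ _ _ _ hD hy.2 hy.1 hk hp.1 (by linarith [hx.1]) hx.2.2.1 hx.2.2.2
        hx.2.1.1 hx.2.1.2).1]
    · have := (key _ _ _ _ _ _ _ _ hD hy.2 hy.1 hk hp.1 (by linarith [hx.1]) hx.2.2.1 hx.2.2.2
        hx.2.1.1 hx.2.1.2).2 hlt (by linarith)
      funext j
      fin_cases j
      · simpa [purchaseFirst] using this.2
      · simpa [purchaseFirst] using this.1

/-! ### Suppliers' revenues; `φ i = true` means that supplier `i` has storage -/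

/-- The revenue of supplier `i` who sells the quantity `x` at the price `p`: the commitment revenue
minus the (expected) penalty for the shortfall. -/
def revenue (M : Market Ω) (φ : Fin 2 → Bool) (i : Fin 2) (p x : ℝ) : ℝ :=
  if φ i then p * x - M.lam * max (x - M.mean i) 0
  else p * x - M.lam * ∫ ω, max (x - M.X i ω) 0 ∂M.P

/-- The inverse of the distribution function of the generation of supplier `i`
(on nonnegative quantities). -/
def invCDF (M : Market Ω) (i : Fin 2) (q : ℝ) : ℝ := sInf {x | 0 ≤ x ∧ q ≤ M.genCDF i x}

/-- The weakly dominant bidding quantity of supplier `i` at the bidding price `p`. -/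
def quantity (M : Market Ω) (φ : Fin 2 → Bool) (i : Fin 2) (p : ℝ) : ℝ :=
  if φ i then M.mean i else M.invCDF i (p / M.lam)

/-- The revenue of supplier `i` at the prices `p` and the weakly dominant quantities, if supplier
`k` is served first. -/
def revenueFirst (M : Market Ω) (φ : Fin 2 → Bool) (p : Fin 2 → ℝ) (k i : Fin 2) : ℝ :=
  M.revenue φ i (p i) (M.purchaseFirst (fun j => M.quantity φ j (p j)) k i)

/-- The probability that supplier `k` is served first: the cheaper supplier is; if the prices are
equal, the order with the larger total revenue of the two suppliers is chosen, and a fair coin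
decides if the totals agree. -/
def priority (M : Market Ω) (φ : Fin 2 → Bool) (p : Fin 2 → ℝ) (k : Fin 2) : ℝ :=
  if p k < p (1 - k) then 1
  else if p (1 - k) < p k then 0
  else if ∑ i, M.revenueFirst φ p (1 - k) i < ∑ i, M.revenueFirst φ p k i then 1
  else if ∑ i, M.revenueFirst φ p k i < ∑ i, M.revenueFirst φ p (1 - k) i then 0
  else 1 / 2

/-- The revenue of supplier `i` in the price competition, at the prices `p`. -/
def payoff (M : Market Ω) (φ : Fin 2 → Bool) (p : Fin 2 → ℝ) (i : Fin 2) : ℝ :=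
  ∑ k, M.priority φ p k * M.revenueFirst φ p k i

/-! ### Price equilibria -/

/-- A pure price equilibrium. -/
def IsPureEquilibrium (M : Market Ω) (φ : Fin 2 → Bool) (p : Fin 2 → ℝ) : Prop :=
  (∀ i, p i ∈ Icc 0 M.pbar) ∧
  ∀ i, ∀ q ∈ Icc 0 M.pbar, M.payoff φ (Function.update p i q) i ≤ M.payoff φ p i

/-- A mixed price strategy: a probability measure on `[0, pbar]`. -/
def IsPriceStrategy (M : Market Ω) (μ : Measure ℝ) : Prop :=
  IsProbabilityMeasure μ ∧ μ (Icc 0 M.pbar)ᶜ = 0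

/-- The expected revenue of supplier `i` if the prices are drawn independently from `μ`. -/
def expectedPayoff (M : Market Ω) (φ : Fin 2 → Bool) (μ : Fin 2 → Measure ℝ) (i : Fin 2) : ℝ :=
  ∫ p, M.payoff φ p i ∂(Measure.pi μ)

/-- A mixed price equilibrium. -/
def IsMixedEquilibrium (M : Market Ω) (φ : Fin 2 → Bool) (μ : Fin 2 → Measure ℝ) : Prop :=
  (∀ i, M.IsPriceStrategy (μ i)) ∧
  ∀ i, ∀ ν, M.IsPriceStrategy ν →
    M.expectedPayoff φ (Function.update μ i ν) i ≤ M.expectedPayoff φ μ i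

/-- `v` is the pair of the suppliers' revenues at some pure or mixed price equilibrium. -/
def IsEquilibriumRevenue (M : Market Ω) (φ : Fin 2 → Bool) (v : Fin 2 → ℝ) : Prop :=
  (∃ p, M.IsPureEquilibrium φ p ∧ v = M.payoff φ p) ∨
  (∃ μ, M.IsMixedEquilibrium φ μ ∧ v = M.expectedPayoff φ μ)

end Market

end

/-! Write S and N for the suppliers with and without storage, `m` for their common mean and `vS`,
`vN` for the equilibrium revenues. N's net revenue when served first, `netFirst`, is continuous and
strictly increasing in his price and bounds everything he can earn at that price. Since `vN` is
positive, there is a price `b > 0` with `netFirst b = vN`, and N almost surely charges at least `b`.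
Ties are resolved in favour of S or do not matter, so by charging `b` S sells `min D m` for sure,
and `vS ≥ b * min D m` (`exists_price`). This exceeds `netFirst b`: if `D ≤ m`, N sells at most `D`
and pays a positive penalty; if `m ≤ D`, even N's unconstrained optimum at price `b` is below `b *
m` (`net_lt`).

For uniform generation `y p = 2 * m * p / λ`, and the optimal net revenue at `p` is `p * y p / 2`.
If `D > m`, then `λ * vN ≤ b * (b * m) ≤ pbar * vS`. If `D ≤ m`, N does not exhaust the demand at
`b` (`sales_lt`), so `vN = b * y b / 2 ≤ b * D / 2 ≤ vS / 2`. If `D = m`, then `vN = b * (b * D) /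
λ`, and the factor 4 amounts to `b ≤ λ / 4`, which follows from `b * D ≤ vS` and `4 * vS ≤ D * λ`
(`four_mul_storage_le`).

The last bound and `sales_lt` rest on `storage_le`: just above almost every price `p` of N there are
prices at which S earns `vS`, or else N would gain by raising his price. Hence `vS ≤ p * (D - N's
expected sales at prices up to p)`. Weighting N's price law by the share of demand he serves turns
this into a distribution function below `1 - w / p` with `w = vS / D`, and an integral inequality
bounds `w`.

The remaining work reduces the market game to this duopoly. -/

noncomputable section

/-! ### The abstract duopoly and its revenue functions. -/

/-- A price duopoly between a supplier with storage, who offers the quantity `m` at every price,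
and a supplier without storage, who offers `y p` at the price `p` and has the expected shortfall
`Φ x` when selling `x`. -/
structure Duopoly where
  D : ℝ
  m : ℝ
  pbar : ℝ
  lam : ℝ
  y : ℝ → ℝ
  Φ : ℝ → ℝ
  D_pos : 0 < D
  m_pos : 0 < m
  pbar_pos : 0 < pbar
  pbar_lt_lam : pbar < lam
  y_mono : Monotone y
  y_zero : y 0 = 0
  y_pos : ∀ p, 0 < p → p ≤ pbar → 0 < y p
  y_small : ∃ q, 0 < q ∧ q ≤ pbar ∧ y q < D
  Φ_zero : Φ 0 = 0
  Φ_mono : Monotone Φ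
  Φ_strictMonoOn : StrictMonoOn Φ (Ici 0)
  net_mono : ∀ p ∈ Icc 0 pbar, ∀ x x', 0 ≤ x → x ≤ x' → x' ≤ y p →
    p * x - lam * Φ x ≤ p * x' - lam * Φ x'
  net_le : ∀ p ∈ Icc 0 pbar, ∀ x, y p ≤ x → p * x - lam * Φ x ≤ p * y p - lam * Φ (y p)
  net_lt : ∀ p, 0 < p → p ≤ pbar → p * y p - lam * Φ (y p) < p * m

namespace Duopoly

variable (G : Duopoly)

/-- Net revenue of the supplier without storage. -/
def net (p x : ℝ) : ℝ := p * x - G.lam * G.Φ x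

/-- Net revenue of the supplier without storage when served first. -/
def netFirst (p : ℝ) : ℝ := G.net p (min G.D (G.y p))

/-- Net revenue of the supplier without storage when served second. -/
def netSecond (p : ℝ) : ℝ := G.net p (min (G.D - min G.D G.m) (G.y p))

/-- Sales of the supplier with storage when served after a competitor with price `p`. -/
def residual (p : ℝ) : ℝ := min (G.D - min G.D (G.y p)) G.m

/-- Revenue of the supplier with storage at the price `q` against the price `p`. -/
def storagePay (q p : ℝ) : ℝ := q * if q ≤ p then min G.D G.m else G.residual p

/-- Revenue of the supplier without storage at the price `p` against the price `q`. -/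
def plainPay (q p : ℝ) : ℝ := if q ≤ p then G.netSecond p else G.netFirst p

lemma lam_pos : 0 < G.lam := G.pbar_pos.trans G.pbar_lt_lam

lemma y_nonneg {p : ℝ} (hp : 0 ≤ p) : 0 ≤ G.y p := G.y_zero ▸ G.y_mono hp

lemma Φ_pos {x : ℝ} (hx : 0 < x) : 0 < G.Φ x := by
  have := G.Φ_strictMonoOn (a := 0) (b := x) (by simp) (by simp [hx.le]) hx
  rwa [G.Φ_zero] at this

lemma net_zero (p : ℝ) : G.net p 0 = 0 := by simp [net, G.Φ_zero]

lemma net_pos {p x : ℝ} (hp : 0 < p) (hp' : p ≤ G.pbar) (hx : 0 < x) (hxy : x ≤ G.y p) :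
    0 < G.net p x := by
  -- Selling this quantity is already not a loss at price `p / 2`, so at price `p` it leaves at
  -- least half of the sales revenue.
  have hz : 0 < min x (G.y (p / 2)) := lt_min hx (G.y_pos _ (by linarith) (by linarith))
  have h1 := G.net_mono p ⟨hp.le, hp'⟩ _ _ hz.le (min_le_left _ _) hxy
  have h2 := G.net_mono (p / 2) ⟨by linarith, by linarith⟩ 0 _ le_rfl hz.le (min_le_right _ _)
  rw [G.Φ_zero] at h2
  have h3 := mul_pos hp hz
  unfold net
  linarith

lemma net_le_netFirst {p x : ℝ} (hp : p ∈ Icc 0 G.pbar) (hx : 0 ≤ x) (hxD : x ≤ G.D) :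
    G.net p x ≤ G.netFirst p := by
  rcases le_total x (G.y p) with h | h
  · exact G.net_mono p hp _ _ hx (le_min hxD h) (min_le_right _ _)
  · rw [netFirst, min_eq_right (h.trans hxD)]
    exact G.net_le p hp x h

lemma netFirst_le_net {p : ℝ} (hp : p ∈ Icc 0 G.pbar) : G.netFirst p ≤ G.net p (G.y p) :=
  G.net_mono p hp _ _ (le_min G.D_pos.le (G.y_nonneg hp.1)) (min_le_right _ _) le_rfl

/-- Envelope inequality: at the price `p'` the quantity sold at `p` is still available as a
comparison, and it does at most as well as the optimum. With either order of the prices it yields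
both strict monotonicity and a Lipschitz bound. -/
lemma mul_le_netFirst_sub {p p' : ℝ} (hp : p ∈ Icc 0 G.pbar) (hp' : p' ∈ Icc 0 G.pbar) :
    (p' - p) * min G.D (G.y p) ≤ G.netFirst p' - G.netFirst p := by
  have h := G.net_le_netFirst hp' (le_min G.D_pos.le (G.y_nonneg hp.1)) (min_le_left G.D (G.y p))
  have : G.netFirst p = G.net p (min G.D (G.y p)) := rfl
  unfold net at *
  linarith

lemma netFirst_zero : G.netFirst 0 = 0 := by
  rw [netFirst, G.y_zero, min_eq_right G.D_pos.le, net_zero]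

lemma netFirst_strictMonoOn : StrictMonoOn G.netFirst (Icc 0 G.pbar) := by
  intro p hp p' hp' h
  -- The midpoint is needed because sales vanish at `p = 0`.
  have hm : (p + p') / 2 ∈ Icc 0 G.pbar :=
    ⟨by linarith [hp.1, hp'.1], by linarith [hp.2, hp'.2]⟩
  have h1 := G.mul_le_netFirst_sub hp hm
  have h2 := G.mul_le_netFirst_sub hm hp'
  have h3 : 0 ≤ ((p + p') / 2 - p) * min G.D (G.y p) :=
    mul_nonneg (by linarith) (le_min G.D_pos.le (G.y_nonneg hp.1))
  have h4 : 0 < (p' - (p + p') / 2) * min G.D (G.y ((p + p') / 2)) :=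
    mul_pos (by linarith) (lt_min G.D_pos (G.y_pos _ (by linarith [hp.1]) hm.2))
  linarith

lemma netFirst_pos {p : ℝ} (hp : 0 < p) (hp' : p ≤ G.pbar) : 0 < G.netFirst p := by
  have := G.netFirst_strictMonoOn ⟨le_rfl, G.pbar_pos.le⟩ ⟨hp.le, hp'⟩ hp
  rwa [netFirst_zero] at this

lemma netFirst_continuousOn : ContinuousOn G.netFirst (Icc 0 G.pbar) := by
  have key : ∀ p ∈ Icc 0 G.pbar, ∀ p' ∈ Icc 0 G.pbar, p ≤ p' →
      |G.netFirst p - G.netFirst p'| ≤ G.D * |p - p'| := by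
    intro p hp p' hp' h
    have h1 := G.netFirst_strictMonoOn.monotoneOn hp hp' h
    have h2 := G.mul_le_netFirst_sub hp' hp
    have h3 := mul_le_mul_of_nonneg_left (min_le_left G.D (G.y p')) (sub_nonneg.2 h)
    rw [abs_of_nonpos (by linarith), abs_of_nonpos (by linarith)]
    linarith
  refine LipschitzOnWith.continuousOn (K := ⟨G.D, G.D_pos.le⟩)
    (LipschitzOnWith.of_dist_le_mul fun p hp p' hp' => ?_)
  rw [Real.dist_eq, Real.dist_eq]
  rcases le_total p p' with h | h
  · exact key p hp p' hp' h
  · rw [abs_sub_comm, abs_sub_comm p]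
    exact key p' hp' p hp h

lemma netSecond_nonneg {p : ℝ} (hp : p ∈ Icc 0 G.pbar) : 0 ≤ G.netSecond p := by
  have h := G.net_mono p hp 0 (min (G.D - min G.D G.m) (G.y p)) le_rfl
    (le_min (sub_nonneg.2 (min_le_left _ _)) (G.y_nonneg hp.1)) (min_le_right _ _)
  have h0 := G.net_zero p
  unfold net at h0
  unfold netSecond net
  linarith

lemma netSecond_le_netFirst {p : ℝ} (hp : p ∈ Icc 0 G.pbar) : G.netSecond p ≤ G.netFirst p :=
  G.net_le_netFirst hp (le_min (sub_nonneg.2 (min_le_left _ _)) (G.y_nonneg hp.1))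
    ((min_le_left _ _).trans (by linarith [le_min G.D_pos.le G.m_pos.le]))

lemma netSecond_pos {p : ℝ} (hm : G.m < G.D) (hp : 0 < p) (hp' : p ≤ G.pbar) :
    0 < G.netSecond p := by
  refine G.net_pos hp hp' (lt_min ?_ (G.y_pos p hp hp')) (min_le_right _ _)
  rw [min_eq_right hm.le]
  linarith

lemma netSecond_eq_zero {p : ℝ} (hm : G.D ≤ G.m) (hp : 0 ≤ p) : G.netSecond p = 0 := by
  rw [netSecond, min_eq_left hm, sub_self, min_eq_left (G.y_nonneg hp), net_zero]

lemma residual_eq {p : ℝ} (hm : G.D ≤ G.m) (hp : 0 ≤ p) :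
    G.residual p = G.D - min G.D (G.y p) :=
  min_eq_left (by linarith [le_min G.D_pos.le (G.y_nonneg hp)])

lemma residual_nonneg (p : ℝ) : 0 ≤ G.residual p :=
  le_min (sub_nonneg.2 (min_le_left _ _)) G.m_pos.le

lemma residual_le {p : ℝ} (hp : 0 ≤ p) : G.residual p ≤ min G.D G.m :=
  min_le_min_right _ (by linarith [le_min G.D_pos.le (G.y_nonneg hp)])

/-- At equal prices, serving the supplier with storage first yields the larger total revenue,
unless the order of service does not matter. -/
lemma tie {p : ℝ} (hp : p ∈ Icc 0 G.pbar) :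
    (G.residual p = min G.D G.m ∧ G.netFirst p = G.netSecond p) ∨
    p * G.residual p + G.netFirst p < p * min G.D G.m + G.netSecond p := by
  have hD := G.D_pos
  have hm := G.m_pos
  rcases hp.1.eq_or_lt with rfl | h0
  · left
    simp only [residual, netFirst, netSecond, G.y_zero, min_eq_right hD.le, sub_zero, true_and]
    rw [min_eq_right (sub_nonneg.2 (min_le_left _ _))]
  have hy := G.y_pos p h0 hp.2
  rcases le_or_gt (G.y p + G.m) G.D with h | h
  · left
    simp only [residual, netFirst, netSecond]
    rw [min_eq_right (a := G.D) (b := G.y p) (by linarith),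
      min_eq_right (a := G.D) (b := G.m) (by linarith), min_eq_right (by linarith),
      min_eq_right (by linarith)]
    exact ⟨rfl, rfl⟩
  · right
    have hlt : G.D - min G.D G.m < min G.D (G.y p) := by
      refine lt_min (by linarith [lt_min hD hm]) ?_
      rcases min_cases G.D G.m with ⟨h1, _⟩ | ⟨h1, _⟩ <;> rw [h1] <;> linarith
    have h1 : min (G.D - min G.D G.m) (G.y p) = G.D - min G.D G.m :=
      min_eq_left (hlt.le.trans (min_le_right _ _))
    have h2 : G.residual p = G.D - min G.D (G.y p) := by
      refine min_eq_left ?_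
      rcases min_cases G.D (G.y p) with ⟨h1, _⟩ | ⟨h1, _⟩ <;> rw [h1] <;> linarith
    have h3 : 0 ≤ G.D - min G.D G.m := sub_nonneg.2 (min_le_left _ _)
    -- Both orders sell the same total quantity at the same price; they differ only in the penalty,
    -- which is larger when the supplier without storage sells more.
    have h4 := mul_lt_mul_of_pos_left
      (G.Φ_strictMonoOn (mem_Ici.2 h3) (mem_Ici.2 (h3.trans hlt.le)) hlt) G.lam_pos
    rw [netFirst, netSecond, h1, h2]
    unfold net
    linarith

lemma measurable_residual : Measurable G.residual :=
  (measurable_const.sub (measurable_const.min G.y_mono.measurable)).min measurable_const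

lemma measurable_net {f : ℝ → ℝ} (hf : Measurable f) : Measurable fun p => G.net p (f p) :=
  (measurable_id.mul hf).sub ((G.Φ_mono.measurable.comp hf).const_mul _)

lemma measurable_netFirst : Measurable G.netFirst :=
  G.measurable_net (measurable_const.min G.y_mono.measurable)

lemma measurable_netSecond : Measurable G.netSecond :=
  G.measurable_net (measurable_const.min G.y_mono.measurable)

lemma measurable_storagePay : Measurable fun z : ℝ × ℝ => G.storagePay z.1 z.2 :=
  measurable_fst.mul (Measurable.ite (measurableSet_le measurable_fst measurable_snd)
    measurable_const (G.measurable_residual.comp measurable_snd))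

lemma measurable_plainPay : Measurable fun z : ℝ × ℝ => G.plainPay z.1 z.2 :=
  Measurable.ite (measurableSet_le measurable_fst measurable_snd)
    (G.measurable_netSecond.comp measurable_snd) (G.measurable_netFirst.comp measurable_snd)

lemma storagePay_nonneg {q : ℝ} (hq : 0 ≤ q) (p : ℝ) : 0 ≤ G.storagePay q p := by
  refine mul_nonneg hq ?_
  split_ifs
  · exact le_min G.D_pos.le G.m_pos.le
  · exact G.residual_nonneg p

lemma storagePay_le {q p : ℝ} (hq : 0 ≤ q) (hp : 0 ≤ p) :
    G.storagePay q p ≤ q * min G.D G.m := by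
  refine mul_le_mul_of_nonneg_left ?_ hq
  split_ifs
  · exact le_rfl
  · exact G.residual_le hp

lemma plainPay_nonneg (q : ℝ) {p : ℝ} (hp : p ∈ Icc 0 G.pbar) : 0 ≤ G.plainPay q p := by
  unfold plainPay
  split_ifs
  · exact G.netSecond_nonneg hp
  · exact (G.netSecond_nonneg hp).trans (G.netSecond_le_netFirst hp)

lemma plainPay_le (q : ℝ) {p : ℝ} (hp : p ∈ Icc 0 G.pbar) :
    G.plainPay q p ≤ G.netFirst p := by
  unfold plainPay
  split_ifs
  · exact G.netSecond_le_netFirst hp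
  · exact le_rfl

lemma netSecond_le_plainPay (q : ℝ) {p : ℝ} (hp : p ∈ Icc 0 G.pbar) :
    G.netSecond p ≤ G.plainPay q p := by
  unfold plainPay
  split_ifs
  · exact le_rfl
  · exact G.netSecond_le_netFirst hp

lemma integrable_storagePay {ν : Measure ℝ} [IsFiniteMeasure ν]
    (hν : ∀ᵐ p ∂ν, p ∈ Icc 0 G.pbar) {q : ℝ} (hq : 0 ≤ q) : Integrable (G.storagePay q) ν := by
  refine Integrable.of_bound
    (G.measurable_storagePay.comp measurable_prodMk_left).aestronglyMeasurable
    (q * min G.D G.m) ?_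
  filter_upwards [hν] with p hp
  rw [Real.norm_of_nonneg (G.storagePay_nonneg hq p)]
  exact G.storagePay_le hq hp.1

lemma integrable_plainPay {σ : Measure ℝ} [IsFiniteMeasure σ] {p : ℝ}
    (hp : p ∈ Icc 0 G.pbar) : Integrable (fun q => G.plainPay q p) σ := by
  refine Integrable.of_bound
    (G.measurable_plainPay.comp measurable_prodMk_right).aestronglyMeasurable
    (G.netFirst p) (Filter.Eventually.of_forall fun q => ?_)
  rw [Real.norm_of_nonneg (G.plainPay_nonneg q hp)]
  exact G.plainPay_le q hp

/-! ### Equilibria: positive revenues and the strict comparison. -/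

/-- `σ` and `ν` are the price distributions of the suppliers with and without storage at a mixed
equilibrium, and `vS` and `vN` their revenues. -/
structure IsEquilibrium (σ ν : Measure ℝ) (vS vN : ℝ) : Prop where
  probS : IsProbabilityMeasure σ
  probN : IsProbabilityMeasure ν
  memS : ∀ᵐ q ∂σ, q ∈ Icc 0 G.pbar
  memN : ∀ᵐ p ∂ν, p ∈ Icc 0 G.pbar
  leS : ∀ q ∈ Icc 0 G.pbar, ∫ p, G.storagePay q p ∂ν ≤ vS
  eqS : ∀ᵐ q ∂σ, ∫ p, G.storagePay q p ∂ν = vS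
  leN : ∀ p ∈ Icc 0 G.pbar, ∫ q, G.plainPay q p ∂σ ≤ vN
  eqN : ∀ᵐ p ∂ν, ∫ q, G.plainPay q p ∂σ = vN

namespace IsEquilibrium

variable {G} {σ ν : Measure ℝ} {vS vN : ℝ}

/-- If `m < D`, demand is left over even for the supplier served second. Otherwise the supplier with
storage can secure a positive revenue, which keeps his prices away from zero, so that there is a
positive price undercutting all of them. -/
lemma plain_pos (h : G.IsEquilibrium σ ν vS vN) : 0 < vN := by
  have := h.probS
  have := h.probN
  rcases lt_or_ge G.m G.D with hm | hm
  · have hp : G.pbar ∈ Icc 0 G.pbar := ⟨G.pbar_pos.le, le_rfl⟩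
    refine (G.netSecond_pos hm G.pbar_pos le_rfl).trans_le (le_trans ?_ (h.leN _ hp))
    calc G.netSecond G.pbar = ∫ _, G.netSecond G.pbar ∂σ := by simp
      _ ≤ _ := integral_mono (integrable_const _) (G.integrable_plainPay hp)
        fun q => G.netSecond_le_plainPay q hp
  · obtain ⟨q₀, h0, h1, h2⟩ := G.y_small
    have hc : 0 < q₀ * (G.D - G.y q₀) := mul_pos h0 (by linarith)
    have hS : q₀ * (G.D - G.y q₀) ≤ vS := by
      refine le_trans ?_ (h.leS q₀ ⟨h0.le, h1⟩)
      calc q₀ * (G.D - G.y q₀) = ∫ _, q₀ * (G.D - G.y q₀) ∂ν := by simp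
        _ ≤ _ := integral_mono_ae (integrable_const _) (G.integrable_storagePay h.memN h0.le) ?_
      filter_upwards [h.memN] with p hp
      refine mul_le_mul_of_nonneg_left ?_ h0.le
      split_ifs with hle
      · rw [min_eq_left hm]
        linarith [G.y_nonneg h0.le]
      · rw [G.residual_eq hm hp.1]
        linarith [G.y_mono (not_le.1 hle).le, min_le_right G.D (G.y p)]
    set c := q₀ * (G.D - G.y q₀)
    have hD := G.D_pos
    -- Revenue at `q` is at most `q * D`, so `q ≥ c / D`; the factor 2 makes the undercutting
    -- strict, since ties favour storage.
    have hq : ∀ᵐ q ∂σ, c / (2 * G.D) < q := by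
      filter_upwards [h.memS, h.eqS] with q hq hqe
      have : ∫ p, G.storagePay q p ∂ν ≤ q * G.D := by
        calc ∫ p, G.storagePay q p ∂ν ≤ ∫ _, q * G.D ∂ν :=
              integral_mono_ae (G.integrable_storagePay h.memN hq.1) (integrable_const _) ?_
          _ = q * G.D := by simp
        filter_upwards [h.memN] with p hp
        exact (G.storagePay_le hq.1 hp.1).trans
          (mul_le_mul_of_nonneg_left (min_le_left _ _) hq.1)
      rw [div_lt_iff₀ (by linarith)]
      linarith
    have hp0 : 0 < c / (2 * G.D) := by positivity
    have hp1 : c / (2 * G.D) ≤ G.pbar := by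
      rw [div_le_iff₀ (by linarith)]
      have : c ≤ q₀ * G.D :=
        mul_le_mul_of_nonneg_left (by linarith [G.y_nonneg h0.le]) h0.le
      nlinarith
    refine (G.netFirst_pos hp0 hp1).trans_le (le_trans (le_of_eq ?_) (h.leN _ ⟨hp0.le, hp1⟩))
    calc G.netFirst (c / (2 * G.D)) = ∫ _, G.netFirst (c / (2 * G.D)) ∂σ := by simp
      _ = _ := integral_congr_ae ?_
    filter_upwards [hq] with q hq
    simp [plainPay, not_le.2 hq]

lemma exists_price (h : G.IsEquilibrium σ ν vS vN) :
    ∃ b, 0 < b ∧ b ≤ G.pbar ∧ G.netFirst b = vN ∧ (∀ᵐ p ∂ν, b ≤ p) ∧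
    b * min G.D G.m ≤ vS := by
  have := h.probS
  have := h.probN
  have hle : ∀ᵐ p ∂ν, vN ≤ G.netFirst p := by
    filter_upwards [h.memN, h.eqN] with p hp hpe
    rw [← hpe]
    calc ∫ q, G.plainPay q p ∂σ ≤ ∫ _, G.netFirst p ∂σ :=
          integral_mono (G.integrable_plainPay hp) (integrable_const _) fun q => G.plainPay_le q hp
      _ = G.netFirst p := by simp
  have htop : G.pbar ∈ Icc 0 G.pbar := ⟨G.pbar_pos.le, le_rfl⟩
  obtain ⟨p₀, hp₀, hp₀'⟩ := (h.memN.and hle).exists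
  obtain ⟨b, hb, hbe⟩ := intermediate_value_Icc G.pbar_pos.le G.netFirst_continuousOn
    (show vN ∈ Icc _ _ from ⟨by rw [G.netFirst_zero]; exact h.plain_pos.le,
      hp₀'.trans (G.netFirst_strictMonoOn.monotoneOn hp₀ htop hp₀.2)⟩)
  have hb0 : 0 < b := by
    refine hb.1.lt_of_ne fun h0 => h.plain_pos.ne' ?_
    rw [← hbe, ← h0, G.netFirst_zero]
  have hbp : ∀ᵐ p ∂ν, b ≤ p := by
    filter_upwards [h.memN, hle] with p hp hp'
    exact (G.netFirst_strictMonoOn.le_iff_le hb hp).1 (hbe ▸ hp')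
  refine ⟨b, hb0, hb.2, hbe, hbp, le_trans (le_of_eq ?_) (h.leS b hb)⟩
  calc b * min G.D G.m = ∫ _, b * min G.D G.m ∂ν := by simp
    _ = _ := integral_congr_ae ?_
  filter_upwards [hbp] with p hp
  simp [storagePay, hp]

lemma plain_lt_storage (h : G.IsEquilibrium σ ν vS vN) : vN < vS := by
  obtain ⟨b, hb0, hb1, hbe, -, hbS⟩ := h.exists_price
  refine lt_of_lt_of_le ?_ hbS
  rw [← hbe]
  rcases le_total G.D G.m with hm | hm
  · rw [min_eq_left hm]
    have h1 : 0 < min G.D (G.y b) := lt_min G.D_pos (G.y_pos b hb0 hb1)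
    have h2 := mul_pos G.lam_pos (G.Φ_pos h1)
    have h3 := mul_le_mul_of_nonneg_left (min_le_left G.D (G.y b)) hb0.le
    unfold netFirst net
    linarith
  · rw [min_eq_right hm]
    exact (G.netFirst_le_net ⟨hb0.le, hb1⟩).trans_lt (G.net_lt b hb0 hb1)

lemma storage_pos (h : G.IsEquilibrium σ ν vS vN) : 0 < vS := h.plain_pos.trans h.plain_lt_storage

end IsEquilibrium
end Duopoly

/-! ### Measures on the line and their distribution functions. -/

/-- If the distribution function of `η` is at most `C` almost everywhere with respect to `η`, then
so is the total mass. -/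
lemma measure_univ_le_of_ae_measure_Iic_le {η : Measure ℝ} {C : ENNReal}
    (h : ∀ᵐ p ∂η, η (Iic p) ≤ C) : η univ ≤ C := by
  set A : Set ℝ := {p | η (Iic p) ≤ C} with hA
  have hlow : ∀ p ∈ A, ∀ r ≤ p, r ∈ A := fun p hp r hr =>
    (measure_mono (Iic_subset_Iic.2 hr)).trans hp
  have hu : η univ = η A := (measure_congr (Filter.eventuallyEq_univ.2 h)).symm
  rw [hu]
  -- `A` is a lower set of full measure: either it has a greatest element `t` and lies in `Iic t`,
  -- or it is covered by the increasing union of `Iic r` over rational `r ∈ A`.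
  by_cases hmax : ∃ t ∈ A, ∀ p ∈ A, p ≤ t
  · obtain ⟨t, ht, hle⟩ := hmax
    exact (measure_mono hle).trans ht
  · push Not at hmax
    have hsub : A ⊆ ⋃ r : {r : ℚ // (r : ℝ) ∈ A}, Iic (r.1 : ℝ) := by
      intro p hp
      obtain ⟨t, ht, hpt⟩ := hmax p hp
      obtain ⟨r, hr1, hr2⟩ := exists_rat_btwn hpt
      exact mem_iUnion.2 ⟨⟨r, hlow t ht _ hr2.le⟩, hr1.le⟩
    refine (measure_mono hsub).trans ?_
    rw [Directed.measure_iUnion]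
    · exact iSup_le fun r => r.2
    · refine Monotone.directed_le fun r s hrs => Iic_subset_Iic.2 ?_
      exact_mod_cast hrs

lemma measureReal_univ_le_of_ae_measureReal_Iic_le {η : Measure ℝ} [IsFiniteMeasure η] {C : ℝ}
    (hC : 0 ≤ C) (h : ∀ᵐ p ∂η, η.real (Iic p) ≤ C) : η.real univ ≤ C := by
  refine ENNReal.toReal_le_of_le_ofReal hC (measure_univ_le_of_ae_measure_Iic_le ?_)
  filter_upwards [h] with p hp
  exact (ENNReal.le_ofReal_iff_toReal_le (measure_ne_top _ _) hC).2 hp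

lemma monotone_measureReal_Iic (η : Measure ℝ) [IsFiniteMeasure η] :
    Monotone fun p => η.real (Iic p) :=
  fun _ _ h => measureReal_mono (Iic_subset_Iic.2 h)

lemma integrable_measureReal_Iic (η ρ : Measure ℝ) [IsFiniteMeasure η] [IsFiniteMeasure ρ] :
    Integrable (fun p => η.real (Iic p)) ρ := by
  refine Integrable.of_bound (monotone_measureReal_Iic η).measurable.aestronglyMeasurable
    (η.real univ) (Filter.Eventually.of_forall fun p => ?_)
  rw [Real.norm_of_nonneg measureReal_nonneg]
  exact measureReal_mono (subset_univ _)

/-- The square is covered by two mirror-image closed triangles of equal mass; atoms on the diagonal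
are counted twice, hence only an inequality. -/
lemma sq_measureReal_le_integral_Iic (η : Measure ℝ) [IsFiniteMeasure η] :
    η.real univ ^ 2 ≤ 2 * ∫ p, η.real (Iic p) ∂η := by
  set s : Set (ℝ × ℝ) := {z | z.2 ≤ z.1}
  have hs : MeasurableSet s := measurableSet_le measurable_snd measurable_fst
  have h1 : (η.prod η).real s = ∫ p, η.real (Iic p) ∂η := by
    rw [measureReal_def, Measure.prod_apply hs]
    exact (integral_toReal (measurable_measure_prodMk_left hs).aemeasurable
      (Filter.Eventually.of_forall fun _ => measure_lt_top _ _)).symm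
  have h2 : (η.prod η).real (Prod.swap ⁻¹' s) = (η.prod η).real s := by
    rw [measureReal_def, measureReal_def, ← Measure.map_apply measurable_swap hs,
      Measure.prod_swap]
  have h3 : (η.prod η).real univ ≤ (η.prod η).real s + (η.prod η).real (Prod.swap ⁻¹' s) := by
    refine (measureReal_mono fun z _ => ?_).trans (measureReal_union_le _ _)
    exact (le_total z.2 z.1).imp id id
  have h4 : (η.prod η).real univ = η.real univ ^ 2 := by
    rw [← univ_prod_univ, measureReal_prod_prod, sq]
  linarith

/-- A bound on `w` for a measure whose distribution function is at most `1 - w / p`. -/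
lemma four_mul_le_of_ae_le {η : Measure ℝ} [IsFiniteMeasure η] {w lam : ℝ} (hw : 0 < w)
    (hlam : 0 < lam) (htot : η.real univ ≤ 1 - w / lam)
    (hη : ∀ᵐ p ∂η, 0 < p ∧ w ≤ p * (1 - η.real (Iic p)))
    (hone : 1 ≤ ∫ p, max (lam / (2 * p)) 1 ∂η) : 4 * w ≤ lam := by
  set κ := lam / (2 * w) with hκ
  have hκ0 : 0 < κ := by positivity
  set a := η.real (Iio (lam / 2)) with ha
  have hint := integrable_measureReal_Iic η η
  have i1 : Integrable (fun p => κ * (1 - η.real (Iic p))) η :=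
    ((integrable_const 1).sub hint).const_mul κ
  -- Below `lam / 2` the maximum is `lam / (2 * p)`, which the bound on the distribution function
  -- turns into `κ * (1 - η.real (Iic p))`; above it, the maximum is 1.
  have hle : ∫ p, max (lam / (2 * p)) 1 ∂η ≤
      ∫ p, ((Iio (lam / 2)).indicator (fun p => κ * (1 - η.real (Iic p))) p +
        (Iio (lam / 2))ᶜ.indicator (fun _ => 1) p) ∂η := by
    refine integral_mono_of_nonneg
      (Filter.Eventually.of_forall fun p => zero_le_one.trans (le_max_right _ _))
      ((i1.indicator measurableSet_Iio).add
        ((integrable_const 1).indicator measurableSet_Iio.compl)) ?_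
    filter_upwards [hη] with p ⟨hp, hpw⟩
    by_cases hpl : p < lam / 2
    · rw [indicator_of_mem (mem_Iio.2 hpl), indicator_of_notMem (by simpa using hpl), add_zero,
        max_eq_left ((one_le_div (by linarith)).2 (by linarith)), hκ, div_mul_eq_mul_div,
        div_le_div_iff₀ (by linarith) (by linarith)]
      have := mul_le_mul_of_nonneg_left hpw hlam.le
      linarith
    · rw [indicator_of_notMem (by simpa using hpl), indicator_of_mem (by simpa using hpl), zero_add,
        max_eq_right ((div_le_one (by linarith)).2 (by linarith))]
  rw [integral_add (i1.indicator measurableSet_Iio)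
      ((integrable_const 1).indicator measurableSet_Iio.compl),
    integral_indicator measurableSet_Iio, integral_indicator measurableSet_Iio.compl,
    setIntegral_const, integral_const_mul,
    integral_sub (integrable_const 1) (integrable_measureReal_Iic η _), setIntegral_const,
    measureReal_compl measurableSet_Iio, smul_eq_mul, smul_eq_mul, mul_one, mul_one, ← ha] at hle
  have hsq : a ^ 2 ≤ 2 * ∫ p in Iio (lam / 2), η.real (Iic p) ∂η := by
    have h1 := sq_measureReal_le_integral_Iic (η.restrict (Iio (lam / 2)))
    rw [measureReal_restrict_apply_univ] at h1
    refine h1.trans (mul_le_mul_of_nonneg_left ?_ zero_le_two)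
    refine integral_mono (integrable_measureReal_Iic _ _) (integrable_measureReal_Iic _ _)
      fun p => ?_
    exact ENNReal.toReal_mono (measure_ne_top _ _) (Measure.restrict_le_self _)
  have hk := mul_le_mul_of_nonneg_left hsq hκ0.le
  have hwl : w / lam = 1 / (2 * κ) := by
    rw [hκ]
    field_simp
  have hmain : 1 / (2 * κ) ≤ κ * (a - a ^ 2 / 2) - a := by
    rw [← hwl]
    linarith
  rw [div_le_iff₀ (by positivity)] at hmain
  -- Completing the square in `a`, `hmain` gives `1 ≤ (κ - 1) ^ 2 - (κ * a - (κ - 1)) ^ 2`; as `κ >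
  -- 0`, this forces `κ ≥ 2`.
  have h2 : 2 ≤ κ := by
    by_contra! hlt
    nlinarith [sq_nonneg (κ * a - (κ - 1))]
  rw [hκ, le_div_iff₀ (by linarith)] at h2
  linarith

/-! ### Price distributions at equilibrium and the uniform revenue ratios. -/

namespace Duopoly.IsEquilibrium

variable {G : Duopoly} {σ ν : Measure ℝ} {vS vN : ℝ}

lemma integral_plainPay (h : G.IsEquilibrium σ ν vS vN)
    (hm : G.D ≤ G.m) {p : ℝ} (hp : p ∈ Icc 0 G.pbar) :
    ∫ q, G.plainPay q p ∂σ = G.netFirst p * σ.real (Ioi p) := by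
  have := h.probS
  have : (fun q => G.plainPay q p) = (Ioi p).indicator fun _ => G.netFirst p := by
    funext q
    by_cases hq : q ≤ p
    · rw [indicator_of_notMem (by simpa using hq), plainPay, if_pos hq,
        G.netSecond_eq_zero hm hp.1]
    · rw [indicator_of_mem (by simpa using hq), plainPay, if_neg hq]
  rw [this, integral_indicator measurableSet_Ioi, setIntegral_const, smul_eq_mul, mul_comm]

lemma integrable_sales (h : G.IsEquilibrium σ ν vS vN) :
    Integrable (fun p => min G.D (G.y p)) ν := by
  have := h.probN
  refine Integrable.of_bound
    (measurable_const.min G.y_mono.measurable).aestronglyMeasurable G.D ?_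
  filter_upwards [h.memN] with p hp
  rw [Real.norm_of_nonneg (le_min G.D_pos.le (G.y_nonneg hp.1))]
  exact min_le_left _ _

/-- The supplier with storage sets prices directly above almost every price of his competitor. -/
lemma storage_le (h : G.IsEquilibrium σ ν vS vN) (hm : G.D ≤ G.m) :
    ∀ᵐ p ∂ν, vS ≤ p * (G.D - ∫ r in Iic p, min G.D (G.y r) ∂ν) := by
  have := h.probS
  have := h.probN
  filter_upwards [h.memN, h.eqN] with p hp hpe
  rw [h.integral_plainPay hm hp] at hpe
  have hpos : 0 < σ.real (Ioi p) := by
    refine measureReal_nonneg.lt_of_ne fun h0 => h.plain_pos.ne' ?_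
    rw [← hpe, ← h0, mul_zero]
  have hlt : p < G.pbar := by
    by_contra! hge
    refine hpos.ne' ((measureReal_eq_zero_iff).2 ?_)
    refine measure_mono_null (t := (Icc 0 G.pbar)ᶜ) (fun q hq => ?_) h.memS
    exact fun hq' => (hq.trans_le' hge).not_ge hq'.2
  have key : ∀ t, p < t → t ≤ G.pbar →
      vS ≤ t * (G.D - ∫ r in Iic p, min G.D (G.y r) ∂ν) := by
    intro t hpt htb
    have ht : t ∈ Icc 0 G.pbar := ⟨hp.1.trans hpt.le, htb⟩
    -- Otherwise raising the price from `p` to `t` would keep the probability of being served first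
    -- and increase the revenue.
    have hmass : σ (Ioc p t) ≠ 0 := by
      intro h0
      have h1 := h.leN t ht
      rw [h.integral_plainPay hm ht, ← hpe] at h1
      have h2 : σ.real (Ioi t) = σ.real (Ioi p) := by
        refine measureReal_congr (Filter.EventuallyEq.symm ?_)
        rw [← Ioc_union_Ioi_eq_Ioi hpt.le]
        exact union_ae_eq_right_of_ae_eq_empty (ae_eq_empty.2 h0)
      rw [h2] at h1
      exact (le_of_mul_le_mul_right h1 hpos).not_gt (G.netFirst_strictMonoOn hp ht hpt)
    obtain ⟨q, hq, hqm, hqe⟩ : ∃ q ∈ Ioc p t, q ∈ Icc 0 G.pbar ∧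
        ∫ r, G.storagePay q r ∂ν = vS := by
      by_contra! hno
      refine hmass (measure_mono_null (fun q hq => ?_) (h.memS.and h.eqS))
      exact fun ⟨h1, h2⟩ => hno q hq h1 h2
    have hI : ∫ r in Iic p, min G.D (G.y r) ∂ν =
        ∫ r, (Iic p).indicator (fun r => min G.D (G.y r)) r ∂ν :=
      (integral_indicator measurableSet_Iic).symm
    have hint := h.integrable_sales.indicator (measurableSet_Iic (a := p))
    -- A competitor with price at most `p < q` is served first and removes his sales from the
    -- demand; against any other price the whole demand is an upper bound.
    have hle : vS ≤ q * (G.D - ∫ r in Iic p, min G.D (G.y r) ∂ν) := by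
      rw [← hqe]
      calc ∫ r, G.storagePay q r ∂ν
          ≤ ∫ r, q * (G.D - (Iic p).indicator (fun r => min G.D (G.y r)) r) ∂ν :=
            integral_mono_ae (G.integrable_storagePay h.memN hqm.1)
              (((integrable_const _).sub hint).const_mul _) ?_
        _ = _ := by
            rw [integral_const_mul, integral_sub (integrable_const _) hint, hI]
            simp
      filter_upwards [h.memN] with r hr
      refine mul_le_mul_of_nonneg_left ?_ hqm.1
      have hs := le_min G.D_pos.le (G.y_nonneg hr.1)
      by_cases hrp : r ≤ p
      · rw [if_neg (not_le.2 (hrp.trans_lt hq.1)), indicator_of_mem (mem_Iic.2 hrp),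
          G.residual_eq hm hr.1]
      · rw [indicator_of_notMem (by simpa using hrp), min_eq_left hm]
        split_ifs
        · linarith
        · rw [G.residual_eq hm hr.1]
          linarith
    have h3 : 0 < G.D - ∫ r in Iic p, min G.D (G.y r) ∂ν := by
      by_contra! hneg
      have := mul_nonpos_of_nonneg_of_nonpos hqm.1 hneg
      linarith [h.storage_pos]
    exact hle.trans (mul_le_mul_of_nonneg_right hq.2 h3.le)
  refine ge_of_tendsto (x := nhdsWithin p (Ioi p)) (f := fun t =>
    t * (G.D - ∫ r in Iic p, min G.D (G.y r) ∂ν)) ?_ ?_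
  · exact ((continuous_id.mul continuous_const).tendsto p).mono_left nhdsWithin_le_nhds
  · filter_upwards [Ioc_mem_nhdsGT hlt] with t ht
    exact key t ht.1 ht.2

/-- The supplier without storage does not always exhaust the demand. -/
lemma sales_lt (h : G.IsEquilibrium σ ν vS vN)
    (hm : G.D ≤ G.m) {b : ℝ} (hb : ∀ᵐ p ∂ν, b ≤ p) : G.y b < G.D := by
  have := h.probN
  by_contra! hge
  have hD := G.D_pos
  have hpb := G.pbar_pos
  have hvS := h.storage_pos
  -- If the demand were exhausted at every price charged, `storage_le` would keep the distribution
  -- function of `ν` uniformly below 1 at almost every price, contradicting total mass 1.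
  have h1 : ∀ᵐ p ∂ν, ν.real (Iic p) ≤ 1 - vS / (G.pbar * G.D) := by
    filter_upwards [h.memN, h.storage_le hm] with p hp hpe
    have h2 : ∫ r in Iic p, min G.D (G.y r) ∂ν = ν.real (Iic p) * G.D := by
      rw [← smul_eq_mul, ← setIntegral_const]
      refine setIntegral_congr_ae measurableSet_Iic ?_
      filter_upwards [hb] with r hr _
      exact min_eq_left (hge.trans (G.y_mono hr))
    rw [h2] at hpe
    have h3 : 0 ≤ 1 - ν.real (Iic p) := sub_nonneg.2 measureReal_le_one
    have h4 := mul_le_mul_of_nonneg_right hp.2 (mul_nonneg hD.le h3)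
    rw [le_sub_comm, div_le_iff₀ (by positivity)]
    linarith
  obtain ⟨p, hp⟩ := h1.exists
  have h2 := measureReal_univ_le_of_ae_measureReal_Iic_le (measureReal_nonneg.trans hp) h1
  rw [probReal_univ] at h2
  have : 0 < vS / (G.pbar * G.D) := by positivity
  linarith

/-- The measure `η` has as density with respect to `ν` the share of demand that the supplier without
storage serves when first. Then `storage_le` bounds its distribution function, and undoing the
density recovers mass 1, so that `four_mul_le_of_ae_le` applies with `w = vS / D`. -/
lemma four_mul_storage_le (h : G.IsEquilibrium σ ν vS vN) (hm : G.D ≤ G.m)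
    (hy : ∀ p ∈ Icc 0 G.pbar, G.y p = 2 * G.D * p / G.lam) : 4 * vS ≤ G.D * G.lam := by
  have := h.probN
  have hD := G.D_pos
  have hlam := G.lam_pos
  have hvS := h.storage_pos
  set f : ℝ → ℝ := fun p => min G.D (G.y p) / G.D
  have hfm : Measurable f := (measurable_const.min G.y_mono.measurable).div_const _
  have hfi : Integrable f ν := h.integrable_sales.div_const _
  have hf0 : ∀ᵐ p ∂ν, 0 ≤ f p := by
    filter_upwards [h.memN] with p hp
    exact div_nonneg (le_min hD.le (G.y_nonneg hp.1)) hD.le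
  set η := ν.withDensity fun p => ENNReal.ofReal (f p)
  have : IsFiniteMeasure η := isFiniteMeasure_withDensity_ofReal hfi.2
  have hac : η ≪ ν := withDensity_absolutelyContinuous _ _
  have hcdf : ∀ p, η.real (Iic p) = (∫ r in Iic p, min G.D (G.y r) ∂ν) / G.D := by
    intro p
    rw [← integral_div, measureReal_def, withDensity_apply _ measurableSet_Iic,
      ← ofReal_integral_eq_lintegral_ofReal hfi.integrableOn (ae_restrict_of_ae hf0),
      ENNReal.toReal_ofReal (integral_nonneg_of_ae (ae_restrict_of_ae hf0))]
  have key : ∀ᵐ p ∂η, p ∈ Icc 0 G.pbar ∧ vS / G.D ≤ p * (1 - η.real (Iic p)) := by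
    refine hac.ae_le ?_
    filter_upwards [h.memN, h.storage_le hm] with p hp hpe
    refine ⟨hp, ?_⟩
    rw [hcdf, div_le_iff₀ hD]
    refine hpe.trans (le_of_eq ?_)
    field_simp
  have key' : ∀ᵐ p ∂η, 0 < p ∧ vS / G.D ≤ p * (1 - η.real (Iic p)) := by
    filter_upwards [key] with p ⟨hp, hpe⟩
    refine ⟨hp.1.lt_of_ne fun h0 => ?_, hpe⟩
    rw [← h0, zero_mul] at hpe
    exact hpe.not_gt (by positivity)
  have hpos : ∀ᵐ p ∂ν, 0 < p := by
    filter_upwards [h.memN, h.storage_le hm] with p hp hpe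
    refine hp.1.lt_of_ne fun h0 => ?_
    rw [← h0, zero_mul] at hpe
    linarith
  -- The integrand is the reciprocal of the density `f`, because `f p = min 1 (2 * p / λ)`.
  have hone : 1 = ∫ p, max (G.lam / (2 * p)) 1 ∂η := by
    rw [integral_withDensity_eq_integral_toReal_smul hfm.ennreal_ofReal (by simp)]
    calc (1 : ℝ) = ∫ _, 1 ∂ν := by simp
      _ = _ := integral_congr_ae ?_
    filter_upwards [h.memN, hf0, hpos] with p hp hpf hp0
    rw [ENNReal.toReal_ofReal hpf, smul_eq_mul]
    simp only [f, hy p hp]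
    rcases le_total (G.lam) (2 * p) with hl | hl
    · rw [max_eq_right ((div_le_one (by linarith)).2 hl), min_eq_left, div_self hD.ne', mul_one]
      rw [le_div_iff₀ hlam]
      nlinarith
    · rw [max_eq_left ((one_le_div (by linarith)).2 hl), min_eq_right]
      · field_simp
      · rw [div_le_iff₀ hlam]
        nlinarith
  have hC : ∀ᵐ p ∂η, η.real (Iic p) ≤ 1 - vS / G.D / G.lam := by
    filter_upwards [key, key'] with p ⟨hp, _⟩ ⟨hp0, hpe⟩
    rw [le_sub_comm, div_le_iff₀ hlam]
    have h3 : 0 ≤ 1 - η.real (Iic p) := by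
      by_contra! hneg
      have := mul_neg_of_pos_of_neg hp0 hneg
      exact hpe.not_gt (this.trans (by positivity))
    have := mul_le_mul_of_nonneg_right (hp.2.trans G.pbar_lt_lam.le) h3
    linarith
  have hne : η ≠ 0 := by
    intro h0
    rw [h0, integral_zero_measure] at hone
    exact one_ne_zero hone
  have : (ae η).NeBot := ae_neBot.2 hne
  obtain ⟨p, hp⟩ := hC.exists
  have htot := measureReal_univ_le_of_ae_measureReal_Iic_le (measureReal_nonneg.trans hp) hC
  have h4 := four_mul_le_of_ae_le (by positivity) hlam htot key' hone.le
  rw [← mul_div_assoc, div_le_iff₀ hD] at h4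
  linarith

lemma two_mul_plain_le (h : G.IsEquilibrium σ ν vS vN) (hm : G.D ≤ G.m)
    (hnet : ∀ p ∈ Icc 0 G.pbar, G.net p (G.y p) = p * G.y p / 2) : 2 * vN ≤ vS := by
  obtain ⟨b, hb0, hb1, hbe, hb, hbS⟩ := h.exists_price
  have hlt := h.sales_lt hm hb
  rw [netFirst, min_eq_right hlt.le, hnet b ⟨hb0.le, hb1⟩] at hbe
  rw [min_eq_left hm] at hbS
  have := mul_le_mul_of_nonneg_left hlt.le hb0.le
  linarith

lemma four_mul_plain_le (h : G.IsEquilibrium σ ν vS vN) (hm : G.D = G.m)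
    (hy : ∀ p ∈ Icc 0 G.pbar, G.y p = 2 * G.m * p / G.lam)
    (hnet : ∀ p ∈ Icc 0 G.pbar, G.net p (G.y p) = p * G.y p / 2) : 4 * vN ≤ vS := by
  obtain ⟨b, hb0, hb1, hbe, hb, hbS⟩ := h.exists_price
  have hlt := h.sales_lt hm.le hb
  have h4 := h.four_mul_storage_le hm.le (hm ▸ hy)
  have hD := G.D_pos
  have hlam := G.lam_pos
  rw [netFirst, min_eq_right hlt.le, hnet b ⟨hb0.le, hb1⟩, hy b ⟨hb0.le, hb1⟩, ← hm] at hbe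
  rw [min_eq_left hm.le] at hbS
  have h5 : 4 * b ≤ G.lam := by
    refine le_of_mul_le_mul_left ?_ hD
    linarith
  have h6 : 4 * vN = 4 * b * (b * G.D) / G.lam := by
    rw [← hbe]
    ring
  rw [h6, div_le_iff₀ hlam]
  have h7 : 0 ≤ b * G.D := by positivity
  calc 4 * b * (b * G.D) ≤ G.lam * (b * G.D) := mul_le_mul_of_nonneg_right h5 h7
    _ ≤ vS * G.lam := by linarith [mul_le_mul_of_nonneg_left hbS hlam.le]

lemma lam_mul_plain_le (h : G.IsEquilibrium σ ν vS vN) (hm : G.m < G.D)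
    (hy : ∀ p ∈ Icc 0 G.pbar, G.y p = 2 * G.m * p / G.lam)
    (hnet : ∀ p ∈ Icc 0 G.pbar, G.net p (G.y p) = p * G.y p / 2) :
    G.lam * vN ≤ G.pbar * vS := by
  obtain ⟨b, hb0, hb1, hbe, -, hbS⟩ := h.exists_price
  have hbI : b ∈ Icc 0 G.pbar := ⟨hb0.le, hb1⟩
  have hlam := G.lam_pos
  have hle := G.netFirst_le_net hbI
  rw [hbe, hnet b hbI, hy b hbI] at hle
  rw [min_eq_right hm.le] at hbS
  have h1 : G.lam * (b * (2 * G.m * b / G.lam) / 2) = b * (b * G.m) := by field_simp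
  calc G.lam * vN ≤ b * (b * G.m) := h1 ▸ mul_le_mul_of_nonneg_left hle hlam.le
    _ ≤ G.pbar * (b * G.m) := mul_le_mul_of_nonneg_right hb1 (mul_pos hb0 G.m_pos).le
    _ ≤ G.pbar * vS := mul_le_mul_of_nonneg_left hbS G.pbar_pos.le

end Duopoly.IsEquilibrium

/-! ### Shortfall, quantile and the duopoly attached to a market. -/

namespace Market

variable {Ω : Type*} [MeasurableSpace Ω] (M : Market Ω)

/-- The expected shortfall of supplier `j` without storage who sells the quantity `x`. -/
def shortfall (j : Fin 2) (x : ℝ) : ℝ := ∫ ω, max (x - M.X j ω) 0 ∂M.P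

namespace Admissible

variable {M}

lemma integrable_gen (hM : M.Admissible) (j : Fin 2) : Integrable (M.X j) M.P := by
  have := hM.prob
  refine Integrable.of_bound (hM.meas j).aestronglyMeasurable (M.Xbar j) ?_
  filter_upwards [hM.bounded j] with ω hω
  rw [Real.norm_of_nonneg hω.1]
  exact hω.2

lemma integrable_shortfall (hM : M.Admissible) (j : Fin 2)
    (x : ℝ) : Integrable (fun ω => max (x - M.X j ω) 0) M.P := by
  have := hM.prob
  exact ((integrable_const x).sub (hM.integrable_gen j)).pos_part

lemma measurableSet_gen_le (hM : M.Admissible) (j : Fin 2)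
    (x : ℝ) : MeasurableSet {ω | M.X j ω ≤ x} :=
  measurableSet_le (hM.meas j) measurable_const

lemma integral_indicator_gen_le (hM : M.Admissible) (j : Fin 2) (c x : ℝ) :
    ∫ ω, {ω | M.X j ω ≤ x}.indicator (fun _ => c) ω ∂M.P = c * M.genCDF j x := by
  rw [integral_indicator (hM.measurableSet_gen_le j x), setIntegral_const, smul_eq_mul, mul_comm]
  rfl

lemma genCDF_mono (hM : M.Admissible) (j : Fin 2) : Monotone (M.genCDF j) := by
  have := hM.prob
  intro x x' h
  exact measureReal_mono fun ω hω => le_trans hω h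

/-- Generation is almost surely nonnegative, and continuity of the distribution function excludes an
atom at 0. -/
lemma genCDF_zero (hM : M.Admissible) (j : Fin 2) : M.genCDF j 0 = 0 := by
  have := hM.prob
  have hneg : ∀ x < 0, M.genCDF j x = 0 := by
    intro x hx
    refine (measureReal_eq_zero_iff).2 (measure_mono_null (fun ω hω => ?_) (hM.bounded j))
    exact fun h => (h.1.trans hω).not_gt hx
  have h1 : Filter.Tendsto (M.genCDF j) (nhdsWithin 0 (Iio 0)) (nhds (M.genCDF j 0)) :=
    ((hM.cdf_cont j).tendsto 0).mono_left nhdsWithin_le_nhds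
  have h2 : Filter.Tendsto (M.genCDF j) (nhdsWithin 0 (Iio 0)) (nhds 0) :=
    tendsto_const_nhds.congr' (by
      filter_upwards [self_mem_nhdsWithin] with x hx
      exact (hneg x hx).symm)
  exact tendsto_nhds_unique h1 h2

lemma genCDF_Xbar (hM : M.Admissible) (j : Fin 2) : M.genCDF j (M.Xbar j) = 1 := by
  have := hM.prob
  have h : {ω | M.X j ω ≤ M.Xbar j} =ᵐ[M.P] univ :=
    Filter.eventuallyEq_univ.2 ((hM.bounded j).mono fun ω h => h.2)
  rw [genCDF, measureReal_congr h, probReal_univ]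

lemma Xbar_nonneg (hM : M.Admissible) (j : Fin 2) : 0 ≤ M.Xbar j := by
  have := hM.prob
  obtain ⟨ω, hω⟩ := (hM.bounded j).exists
  exact hω.1.trans hω.2

lemma invCDF_nonneg (j : Fin 2) (q : ℝ) : 0 ≤ M.invCDF j q := Real.sInf_nonneg fun _ hx => hx.1

lemma invCDF_le (j : Fin 2) {q x : ℝ} (hx : 0 ≤ x) (hq : q ≤ M.genCDF j x) : M.invCDF j q ≤ x :=
  csInf_le ⟨0, fun _ hx => hx.1⟩ ⟨hx, hq⟩

lemma genCDF_invCDF (hM : M.Admissible) (j : Fin 2)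
    {q : ℝ} (hq : q ∈ Icc 0 1) : M.genCDF j (M.invCDF j q) = q := by
  obtain ⟨x, hx, hxe⟩ := intermediate_value_Icc (hM.Xbar_nonneg j) (hM.cdf_cont j).continuousOn
    (show q ∈ Icc _ _ by rwa [hM.genCDF_zero, hM.genCDF_Xbar])
  refine le_antisymm ((hM.genCDF_mono j (invCDF_le j hx.1 hxe.ge)).trans hxe.le) ?_
  have hcl : IsClosed {x | 0 ≤ x ∧ q ≤ M.genCDF j x} :=
    (isClosed_le continuous_const continuous_id).inter
      (isClosed_le continuous_const (hM.cdf_cont j))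
  exact (hcl.csInf_mem ⟨x, hx.1, hxe.ge⟩ ⟨0, fun _ hx => hx.1⟩).2

/-- The shortfall is convex with derivative `genCDF`; this and `le_shortfall_sub` are its tangent
inequalities, valid for `x` and `x'` in either order. -/
lemma shortfall_sub_le (hM : M.Admissible) (j : Fin 2) (x x' : ℝ) :
    M.shortfall j x' - M.shortfall j x ≤ (x' - x) * M.genCDF j x' := by
  have := hM.prob
  rw [shortfall, shortfall, ← integral_sub (hM.integrable_shortfall j x')
    (hM.integrable_shortfall j x), ← hM.integral_indicator_gen_le]
  refine integral_mono ((hM.integrable_shortfall j x').sub (hM.integrable_shortfall j x))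
    ((integrable_const _).indicator (hM.measurableSet_gen_le j x')) fun ω => ?_
  by_cases hω : M.X j ω ≤ x'
  · rw [indicator_of_mem (by exact hω)]
    simp only [max_eq_left (sub_nonneg.2 hω)]
    linarith [le_max_left (x - M.X j ω) 0]
  · rw [indicator_of_notMem (by exact hω)]
    rw [not_le] at hω
    simp only [max_eq_right (show x' - M.X j ω ≤ 0 by linarith)]
    linarith [le_max_right (x - M.X j ω) 0]

lemma le_shortfall_sub (hM : M.Admissible) (j : Fin 2) (x x' : ℝ) :
    (x' - x) * M.genCDF j x ≤ M.shortfall j x' - M.shortfall j x := by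
  have := hM.prob
  rw [shortfall, shortfall, ← integral_sub (hM.integrable_shortfall j x')
    (hM.integrable_shortfall j x), ← hM.integral_indicator_gen_le]
  refine integral_mono ((integrable_const _).indicator (hM.measurableSet_gen_le j x))
    ((hM.integrable_shortfall j x').sub (hM.integrable_shortfall j x)) fun ω => ?_
  by_cases hω : M.X j ω ≤ x
  · rw [indicator_of_mem (by exact hω)]
    simp only [max_eq_left (sub_nonneg.2 hω)]
    linarith [le_max_left (x' - M.X j ω) 0]
  · rw [indicator_of_notMem (by exact hω)]
    rw [not_le] at hω
    simp only [max_eq_right (show x - M.X j ω ≤ 0 by linarith)]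
    linarith [le_max_right (x' - M.X j ω) 0]

lemma shortfall_mono (hM : M.Admissible) (j : Fin 2) : Monotone (M.shortfall j) := by
  intro x x' h
  have h1 := hM.le_shortfall_sub j x x'
  have h2 : 0 ≤ (x' - x) * M.genCDF j x := mul_nonneg (sub_nonneg.2 h) measureReal_nonneg
  linarith

lemma shortfall_zero (hM : M.Admissible) (j : Fin 2) : M.shortfall j 0 = 0 := by
  refine integral_eq_zero_of_ae ?_
  filter_upwards [hM.bounded j] with ω hω
  simp only [zero_sub, Pi.zero_apply]
  exact max_eq_right (neg_nonpos.2 hω.1)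

lemma shortfall_strictMonoOn (hM : M.Admissible) (j : Fin 2) (hF : ∀ x, 0 < x → 0 < M.genCDF j x) :
    StrictMonoOn (M.shortfall j) (Ici 0) := by
  intro x hx x' _ h
  rw [mem_Ici] at hx
  have h1 := hM.shortfall_mono j (show x ≤ (x + x') / 2 by linarith)
  have h2 := hM.le_shortfall_sub j ((x + x') / 2) x'
  have h3 := mul_pos (show 0 < x' - (x + x') / 2 by linarith)
    (hF ((x + x') / 2) (by linarith))
  linarith

lemma lam_pos (hM : M.Admissible) : 0 < M.lam := hM.cap_pos.trans hM.cap_lt_penalty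

lemma div_lam_mem (hM : M.Admissible) {p : ℝ} (hp : p ∈ Icc 0 M.pbar) : p / M.lam ∈ Icc (0 : ℝ) 1 :=
  ⟨div_nonneg hp.1 hM.lam_pos.le,
    (div_le_one hM.lam_pos).2 (hp.2.trans hM.cap_lt_penalty.le)⟩

lemma lam_mul_genCDF (hM : M.Admissible) (j : Fin 2) {p : ℝ} (hp : p ∈ Icc 0 M.pbar) :
    M.lam * M.genCDF j (M.invCDF j (p / M.lam)) = p := by
  rw [hM.genCDF_invCDF j (hM.div_lam_mem hp), mul_div_cancel₀ _ hM.lam_pos.ne']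

/-- The marginal net revenue `p - λ * F x` is nonnegative up to the quantile `F⁻¹(p / λ)`. -/
lemma net_mono (hM : M.Admissible) (j : Fin 2)
    {p : ℝ} (hp : p ∈ Icc 0 M.pbar) {x x' : ℝ} (h : x ≤ x')
    (hx : x' ≤ M.invCDF j (p / M.lam)) :
    p * x - M.lam * M.shortfall j x ≤ p * x' - M.lam * M.shortfall j x' := by
  have h1 := mul_le_mul_of_nonneg_left (hM.shortfall_sub_le j x x') hM.lam_pos.le
  have h2 := mul_le_mul_of_nonneg_left (hM.genCDF_mono j hx) hM.lam_pos.le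
  rw [hM.lam_mul_genCDF j hp] at h2
  have h3 := mul_le_mul_of_nonneg_left h2 (sub_nonneg.2 h)
  linarith

lemma net_le (hM : M.Admissible) (j : Fin 2) {p : ℝ} (hp : p ∈ Icc 0 M.pbar) (x : ℝ) :
    p * x - M.lam * M.shortfall j x ≤
      p * M.invCDF j (p / M.lam) - M.lam * M.shortfall j (M.invCDF j (p / M.lam)) := by
  have h1 := mul_le_mul_of_nonneg_left (hM.le_shortfall_sub j (M.invCDF j (p / M.lam)) x)
    hM.lam_pos.le
  have h2 : M.lam * ((x - M.invCDF j (p / M.lam)) * M.genCDF j (M.invCDF j (p / M.lam))) =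
      (x - M.invCDF j (p / M.lam)) * p := by
    rw [mul_left_comm, hM.lam_mul_genCDF j hp]
  linarith

/-- Pointwise `p * (y - X) ≤ λ * max (y - X) 0`, strictly where `X > y`, an event of probability `1
- p / λ > 0`. -/
lemma net_lt (hM : M.Admissible) (j : Fin 2) {p : ℝ} (hp : 0 < p) (hp' : p ≤ M.pbar) :
    p * M.invCDF j (p / M.lam) - M.lam * M.shortfall j (M.invCDF j (p / M.lam)) <
      p * M.mean j := by
  have := hM.prob
  set y := M.invCDF j (p / M.lam) with hy
  have hlam := hM.lam_pos
  have hpl : p < M.lam := hp'.trans_lt hM.cap_lt_penalty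
  have i1 := (hM.integrable_shortfall j y).const_mul M.lam
  have i2 : Integrable (fun ω => p * (y - M.X j ω)) M.P :=
    ((integrable_const y).sub (hM.integrable_gen j)).const_mul p
  have heq : ∫ ω, (M.lam * max (y - M.X j ω) 0 - p * (y - M.X j ω)) ∂M.P =
      M.lam * M.shortfall j y - p * (y - M.mean j) := by
    rw [integral_sub i1 i2, integral_const_mul, integral_const_mul,
      integral_sub (integrable_const _) (hM.integrable_gen j)]
    simp [shortfall, mean]
  have hnn : 0 ≤ fun ω => M.lam * max (y - M.X j ω) 0 - p * (y - M.X j ω) := by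
    intro ω
    simp only [Pi.zero_apply]
    rcases le_total (M.X j ω) y with h | h
    · rw [max_eq_left (by linarith), ← sub_mul]
      exact mul_nonneg (by linarith) (by linarith)
    · rw [max_eq_right (by linarith)]
      nlinarith
  have hpos : 0 < ∫ ω, (M.lam * max (y - M.X j ω) 0 - p * (y - M.X j ω)) ∂M.P := by
    rw [integral_pos_iff_support_of_nonneg hnn (i1.sub i2)]
    have hsub : {ω | M.X j ω ≤ y}ᶜ ⊆
        Function.support fun ω => M.lam * max (y - M.X j ω) 0 - p * (y - M.X j ω) := by
      intro ω hω
      simp only [mem_compl_iff, mem_ofPred_eq, not_le] at hω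
      simp only [Function.mem_support, max_eq_right (show y - M.X j ω ≤ 0 by linarith)]
      have := mul_pos hp (sub_pos.2 hω)
      exact ne_of_gt (by linarith)
    refine lt_of_lt_of_le ?_ (measure_mono hsub)
    have h1 : M.P.real {ω | M.X j ω ≤ y}ᶜ = 1 - p / M.lam := by
      rw [probReal_compl_eq_one_sub (hM.measurableSet_gen_le j y)]
      congr 1
      exact hM.genCDF_invCDF j (hM.div_lam_mem ⟨hp.le, hp'⟩)
    have h2 : 0 < M.P.real {ω | M.X j ω ≤ y}ᶜ := by
      rw [h1, sub_pos, div_lt_one hlam]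
      exact hpl
    exact (ENNReal.toReal_pos_iff.1 h2).1
  rw [heq] at hpos
  linarith

lemma mean_pos (hM : M.Admissible) (j : Fin 2) : 0 < M.mean j := by
  have hp : M.pbar ∈ Icc 0 M.pbar := ⟨hM.cap_pos.le, le_rfl⟩
  have h1 := hM.net_lt j hM.cap_pos le_rfl
  have h2 := hM.net_mono j hp (invCDF_nonneg j (M.pbar / M.lam)) le_rfl
  rw [hM.shortfall_zero] at h2
  exact pos_of_mul_pos_right (a := M.pbar) (by linarith) hM.cap_pos.le

lemma invCDF_zero (hM : M.Admissible) (j : Fin 2) : M.invCDF j 0 = 0 :=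
  le_antisymm (invCDF_le j le_rfl (hM.genCDF_zero j).ge) (invCDF_nonneg j 0)

lemma invCDF_monotoneOn (hM : M.Admissible) (j : Fin 2) : MonotoneOn (M.invCDF j) (Icc 0 1) := by
  intro q _ q' hq' h
  exact invCDF_le j (invCDF_nonneg j q') (h.trans (hM.genCDF_invCDF j hq').ge)

lemma invCDF_pos (hM : M.Admissible) (j : Fin 2)
    {q : ℝ} (hq : 0 < q) (hq' : q ≤ 1) : 0 < M.invCDF j q := by
  refine (invCDF_nonneg j q).lt_of_ne fun h => ?_
  have := hM.genCDF_invCDF j ⟨hq.le, hq'⟩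
  rw [← h, hM.genCDF_zero] at this
  exact hq.ne this

/-- The price duopoly in which supplier `j` has no storage and his competitor, with the same mean
generation, has. -/
def duopoly (hM : M.Admissible) (j : Fin 2) (hF : ∀ x, 0 < x → 0 < M.genCDF j x) : Duopoly :=
  have hproj (p : ℝ) (hp : p ∈ Icc 0 M.pbar) : max 0 (min M.pbar p) = p := by
    rw [min_eq_right hp.2, max_eq_right hp.1]
  have hmem (p : ℝ) : max 0 (min M.pbar p) ∈ Icc 0 M.pbar :=
    ⟨le_max_left _ _, max_le hM.cap_pos.le (min_le_left _ _)⟩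
  { D := M.D
    m := M.mean j
    pbar := M.pbar
    lam := M.lam
    -- Clamping the price to `[0, pbar]` makes the quantity monotone, hence measurable, on the whole
    -- line.
    y := fun p => M.invCDF j (max 0 (min M.pbar p) / M.lam)
    Φ := M.shortfall j
    D_pos := hM.demand_pos
    m_pos := hM.mean_pos j
    pbar_pos := hM.cap_pos
    pbar_lt_lam := hM.cap_lt_penalty
    y_mono := fun p p' h => hM.invCDF_monotoneOn j (hM.div_lam_mem (hmem p))
      (hM.div_lam_mem (hmem p')) (div_le_div_of_nonneg_right
        (max_le_max le_rfl (min_le_min le_rfl h)) hM.lam_pos.le)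
    y_zero := by
      rw [hproj 0 ⟨le_rfl, hM.cap_pos.le⟩, zero_div]
      exact hM.invCDF_zero j
    y_pos := fun p hp hp' => by
      rw [hproj p ⟨hp.le, hp'⟩]
      exact hM.invCDF_pos j (div_pos hp hM.lam_pos) (hM.div_lam_mem ⟨hp.le, hp'⟩).2
    y_small := by
      have hD := hM.demand_pos
      -- At a price of at most `λ * F(D / 2)` the quantity offered is at most `D / 2`.
      have h0 : 0 < min M.pbar (M.lam * M.genCDF j (M.D / 2)) :=
        lt_min hM.cap_pos (mul_pos hM.lam_pos (hF _ (by linarith)))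
      refine ⟨_, h0, min_le_left _ _, ?_⟩
      rw [hproj _ ⟨h0.le, min_le_left _ _⟩]
      refine (invCDF_le j (x := M.D / 2) (by linarith) ?_).trans_lt (by linarith)
      rw [div_le_iff₀ hM.lam_pos, mul_comm]
      exact min_le_right _ _
    Φ_zero := hM.shortfall_zero j
    Φ_mono := hM.shortfall_mono j
    Φ_strictMonoOn := hM.shortfall_strictMonoOn j hF
    net_mono := fun p hp x x' _ h hx => by
      rw [hproj p hp] at hx
      exact hM.net_mono j hp h hx
    net_le := fun p hp x _ => by
      rw [hproj p hp]
      exact hM.net_le j hp x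
    net_lt := fun p hp hp' => by
      rw [hproj p ⟨hp.le, hp'⟩]
      exact hM.net_lt j hp hp' }

lemma duopoly_y (hM : M.Admissible) (j : Fin 2)
    (hF : ∀ x, 0 < x → 0 < M.genCDF j x) {p : ℝ} (hp : p ∈ Icc 0 M.pbar) :
    (hM.duopoly j hF).y p = M.invCDF j (p / M.lam) := by
  change M.invCDF j (max 0 (min M.pbar p) / M.lam) = _
  rw [min_eq_right hp.2, max_eq_right hp.1]

end Admissible
end Market

/-! ### Two-player bookkeeping and integrability on the product. -/

lemma Fin.sum_two_eq (f : Fin 2 → ℝ) (i : Fin 2) : ∑ k, f k = f i + f (1 - i) := by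
  fin_cases i
  · simp [Fin.sum_univ_two]
  · simp [Fin.sum_univ_two, add_comm]

lemma Fin.one_sub_one_sub (i : Fin 2) : 1 - (1 - i) = i := by
  fin_cases i <;> rfl

lemma Fin.one_sub_ne (i : Fin 2) : 1 - i ≠ i := by
  fin_cases i <;> decide

lemma integral_pi_two (μ : Fin 2 → Measure ℝ) [∀ k, IsProbabilityMeasure (μ k)] (i : Fin 2)
    (f : ℝ × ℝ → ℝ) :
    ∫ p, f (p i, p (1 - i)) ∂Measure.pi μ = ∫ z, f z ∂(μ i).prod (μ (1 - i)) := by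
  have h0 : ∀ f : ℝ × ℝ → ℝ, ∫ p, f (p 0, p 1) ∂Measure.pi μ = ∫ z, f z ∂(μ 0).prod (μ 1) :=
    fun f => (measurePreserving_piFinTwo μ).integral_comp' f
  fin_cases i
  · exact h0 f
  · exact (h0 fun z => f z.swap).trans (integral_prod_swap f)

lemma ae_eq_of_ae_le_of_integral_eq {ρ : Measure ℝ} [IsProbabilityMeasure ρ] {u : ℝ → ℝ} {c : ℝ}
    (hu : Integrable u ρ) (hle : ∀ᵐ x ∂ρ, u x ≤ c) (heq : c = ∫ x, u x ∂ρ) :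
    ∀ᵐ x ∂ρ, u x = c := by
  have h0 : ∫ x, (c - u x) ∂ρ = 0 := by
    rw [integral_sub (integrable_const c) hu, ← heq]
    simp
  have h1 := (integral_eq_zero_iff_of_nonneg_ae (hle.mono fun x hx => sub_nonneg.2 hx)
    ((integrable_const c).sub hu)).1 h0
  filter_upwards [h1] with x hx
  exact (sub_eq_zero.1 hx).symm

namespace Duopoly

variable (G : Duopoly)

lemma integrable_storagePay_prod {σ ν : Measure ℝ} [IsProbabilityMeasure σ]
    [IsProbabilityMeasure ν] (hσ : ∀ᵐ q ∂σ, q ∈ Icc 0 G.pbar) (hν : ∀ᵐ p ∂ν, p ∈ Icc 0 G.pbar) :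
    Integrable (fun z : ℝ × ℝ => G.storagePay z.1 z.2) (σ.prod ν) := by
  refine Integrable.of_bound G.measurable_storagePay.aestronglyMeasurable
    (G.pbar * min G.D G.m) ?_
  filter_upwards [Measure.quasiMeasurePreserving_fst.ae hσ,
    Measure.quasiMeasurePreserving_snd.ae hν] with z h1 h2
  rw [Real.norm_of_nonneg (G.storagePay_nonneg h1.1 _)]
  exact (G.storagePay_le h1.1 h2.1).trans
    (mul_le_mul_of_nonneg_right h1.2 (le_min G.D_pos.le G.m_pos.le))

lemma integrable_plainPay_prod {σ ν : Measure ℝ} [IsProbabilityMeasure σ]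
    [IsProbabilityMeasure ν] (hν : ∀ᵐ p ∂ν, p ∈ Icc 0 G.pbar) :
    Integrable (fun z : ℝ × ℝ => G.plainPay z.1 z.2) (σ.prod ν) := by
  refine Integrable.of_bound G.measurable_plainPay.aestronglyMeasurable
    (G.netFirst G.pbar) ?_
  filter_upwards [Measure.quasiMeasurePreserving_snd.ae hν] with z h2
  rw [Real.norm_of_nonneg (G.plainPay_nonneg _ h2)]
  exact (G.plainPay_le _ h2).trans
    (G.netFirst_strictMonoOn.monotoneOn h2 ⟨G.pbar_pos.le, le_rfl⟩ h2.2)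

end Duopoly

namespace Market

variable {Ω : Type*} [MeasurableSpace Ω] {M : Market Ω}

lemma isPriceStrategy_dirac {q : ℝ} (hq : q ∈ Icc 0 M.pbar) :
    M.IsPriceStrategy (Measure.dirac q) :=
  ⟨inferInstance, by rw [Measure.dirac_apply' _ measurableSet_Icc.compl]; simp [hq.1, hq.2]⟩

namespace Admissible

/-! ### Explicit formulas for uniform generation. -/

section Uniform

lemma Xbar_pos (hM : M.Admissible) (j : Fin 2) : 0 < M.Xbar j := by
  refine (hM.Xbar_nonneg j).lt_of_ne fun h => ?_
  have := hM.genCDF_Xbar j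
  rw [← h, hM.genCDF_zero] at this
  exact zero_ne_one this

lemma integral_uniform (hM : M.Admissible) (j : Fin 2)
    (hU : pdf.IsUniform (M.X j) (Icc 0 (M.Xbar j)) M.P volume) {f : ℝ → ℝ} (hf : Continuous f) :
    ∫ ω, f (M.X j ω) ∂M.P = (M.Xbar j)⁻¹ * ∫ x in 0..M.Xbar j, f x := by
  have h0 := hM.Xbar_nonneg j
  rw [← integral_map (hM.meas j).aemeasurable hf.aestronglyMeasurable, hU, ProbabilityTheory.cond,
    integral_smul_measure, intervalIntegral.integral_of_le h0, integral_Icc_eq_integral_Ioc,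
    Real.volume_Icc, sub_zero, ENNReal.toReal_inv, ENNReal.toReal_ofReal h0, smul_eq_mul]

lemma mean_uniform (hM : M.Admissible) (j : Fin 2)
    (hU : pdf.IsUniform (M.X j) (Icc 0 (M.Xbar j)) M.P volume) : M.mean j = M.Xbar j / 2 := by
  have h := hM.integral_uniform j hU continuous_id
  have h0 := hM.Xbar_pos j
  simp only [id] at h
  rw [mean, h, integral_id]
  field_simp
  ring

lemma shortfall_uniform (hM : M.Admissible) (j : Fin 2)
    (hU : pdf.IsUniform (M.X j) (Icc 0 (M.Xbar j)) M.P volume) {x : ℝ} (hx : x ∈ Icc 0 (M.Xbar j)) :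
    M.shortfall j x = x ^ 2 / (2 * M.Xbar j) := by
  have hc : Continuous fun t : ℝ => max (x - t) 0 :=
    (continuous_const.sub continuous_id).max continuous_const
  have h0 := hM.Xbar_pos j
  have h := hM.integral_uniform j hU hc
  have h1 : ∫ t in 0..x, max (x - t) 0 = ∫ t in 0..x, (x - t) := by
    refine intervalIntegral.integral_congr fun t ht => ?_
    rw [uIcc_of_le hx.1] at ht
    exact max_eq_left (sub_nonneg.2 ht.2)
  have h2 : ∫ t in x..M.Xbar j, max (x - t) 0 = ∫ _ in x..M.Xbar j, (0 : ℝ) := by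
    refine intervalIntegral.integral_congr fun t ht => ?_
    rw [uIcc_of_le hx.2] at ht
    exact max_eq_right (sub_nonpos.2 ht.1)
  rw [← intervalIntegral.integral_add_adjacent_intervals (b := x) (hc.intervalIntegrable _ _)
    (hc.intervalIntegrable _ _), h1, h2, intervalIntegral.integral_sub (by simp) (by simp)] at h
  rw [shortfall, h]
  simp
  field_simp
  ring

lemma genCDF_uniform (hM : M.Admissible) (j : Fin 2)
    (hU : pdf.IsUniform (M.X j) (Icc 0 (M.Xbar j)) M.P volume)
    {x : ℝ} (hx : x ∈ Icc 0 (M.Xbar j)) : M.genCDF j x = x / M.Xbar j := by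
  have h0 := hM.Xbar_pos j
  have hv : volume (Icc 0 (M.Xbar j)) = ENNReal.ofReal (M.Xbar j) := by simp
  have h := hU.measure_preimage (by rw [hv]; simpa using h0) (by rw [hv]; simp)
    (measurableSet_Iic (a := x))
  have h1 : Icc 0 (M.Xbar j) ∩ Iic x = Icc 0 x := by
    ext t
    simp only [mem_inter_iff, mem_Icc, mem_Iic]
    exact ⟨fun h => ⟨h.1.1, h.2⟩, fun h => ⟨⟨h.1, h.2.trans hx.2⟩, h.2⟩⟩
  rw [h1, hv, Real.volume_Icc, sub_zero] at h
  change (M.P (M.X j ⁻¹' Iic x)).toReal = _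
  rw [h, ENNReal.toReal_div, ENNReal.toReal_ofReal hx.1, ENNReal.toReal_ofReal h0.le]

lemma invCDF_uniform (hM : M.Admissible) (j : Fin 2)
    (hU : pdf.IsUniform (M.X j) (Icc 0 (M.Xbar j)) M.P volume)
    {q : ℝ} (hq : q ∈ Icc 0 1) : M.invCDF j q = M.Xbar j * q := by
  have h := hM.genCDF_invCDF j hq
  rw [hM.genCDF_uniform j hU ⟨invCDF_nonneg j q, invCDF_le j (hM.Xbar_nonneg j)
    (by rw [hM.genCDF_Xbar]; exact hq.2)⟩, div_eq_iff (hM.Xbar_pos j).ne'] at h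
  rw [h, mul_comm]

lemma duopoly_y_uniform (hM : M.Admissible) (j : Fin 2)
    (hU : pdf.IsUniform (M.X j) (Icc 0 (M.Xbar j)) M.P volume)
    (hF : ∀ x, 0 < x → 0 < M.genCDF j x) (p : ℝ)
    (hp : p ∈ Icc 0 M.pbar) :
    (hM.duopoly j hF).y p = 2 * M.mean j * p / M.lam := by
  rw [hM.duopoly_y j hF hp, hM.invCDF_uniform j hU (hM.div_lam_mem hp), hM.mean_uniform j hU]
  ring

lemma duopoly_net_uniform (hM : M.Admissible) (j : Fin 2)
    (hU : pdf.IsUniform (M.X j) (Icc 0 (M.Xbar j)) M.P volume)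
    (hF : ∀ x, 0 < x → 0 < M.genCDF j x) (p : ℝ)
    (hp : p ∈ Icc 0 M.pbar) :
    (hM.duopoly j hF).net p ((hM.duopoly j hF).y p) = p * (hM.duopoly j hF).y p / 2 := by
  have hd := hM.div_lam_mem hp
  have h0 := hM.Xbar_pos j
  have hlam := hM.lam_pos
  rw [hM.duopoly_y j hF hp, hM.invCDF_uniform j hU hd]
  change p * _ - M.lam * M.shortfall j _ = _
  rw [hM.shortfall_uniform j hU ⟨mul_nonneg h0.le hd.1, mul_le_of_le_one_right h0.le hd.2⟩]
  field_simp
  ring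

end Uniform

/-! ### Reduction of the market's price game to the duopoly. -/

section Storage

variable {φ : Fin 2 → Bool} {i : Fin 2}

lemma revenueFirst_eq (hM : M.Admissible) (hi : φ i = true) (hj : φ (1 - i) = false)
    (hF : ∀ x, 0 < x → 0 < M.genCDF (1 - i) x) (hmean : M.mean i = M.mean (1 - i))
    {P : Fin 2 → ℝ} (hP : ∀ k, P k ∈ Icc 0 M.pbar) :
    M.revenueFirst φ P i i =
      P i * min (hM.duopoly (1 - i) hF).D (hM.duopoly (1 - i) hF).m ∧
    M.revenueFirst φ P i (1 - i) = (hM.duopoly (1 - i) hF).netSecond (P (1 - i)) ∧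
    M.revenueFirst φ P (1 - i) i =
      P i * (hM.duopoly (1 - i) hF).residual (P (1 - i)) ∧
    M.revenueFirst φ P (1 - i) (1 - i) = (hM.duopoly (1 - i) hF).netFirst (P (1 - i)) := by
  have hq : M.quantity φ i (P i) = (hM.duopoly (1 - i) hF).m := by
    rw [quantity, if_pos hi, hmean]
    rfl
  have hq' : M.quantity φ (1 - i) (P (1 - i)) = (hM.duopoly (1 - i) hF).y (P (1 - i)) := by
    rw [quantity, hj, hM.duopoly_y _ hF (hP _)]
    simp
  have hr : ∀ p x, x ≤ M.mean (1 - i) → M.revenue φ i p x = p * x := by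
    intro p x hx
    rw [revenue, if_pos hi, hmean, max_eq_right (sub_nonpos.2 hx)]
    ring
  have hr' : ∀ p x, M.revenue φ (1 - i) p x = (hM.duopoly (1 - i) hF).net p x := by
    intro p x
    rw [revenue, hj]
    simp only [Bool.false_eq_true, if_false]
    rfl
  have hne := Fin.one_sub_ne i
  simp only [revenueFirst, purchaseFirst, if_neg hne, if_neg hne.symm, if_true, hq, hq']
  exact ⟨hr _ _ (min_le_right _ _), hr' _ _, hr _ _ (min_le_right _ _), hr' _ _⟩

lemma payoff_eq (hM : M.Admissible) (hi : φ i = true) (hj : φ (1 - i) = false)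
    (hF : ∀ x, 0 < x → 0 < M.genCDF (1 - i) x) (hmean : M.mean i = M.mean (1 - i))
    {P : Fin 2 → ℝ} (hP : ∀ k, P k ∈ Icc 0 M.pbar) :
    M.payoff φ P i = (hM.duopoly (1 - i) hF).storagePay (P i) (P (1 - i)) ∧
    M.payoff φ P (1 - i) = (hM.duopoly (1 - i) hF).plainPay (P i) (P (1 - i)) := by
  obtain ⟨h1, h2, h3, h4⟩ := hM.revenueFirst_eq hi hj hF hmean hP
  simp only [payoff, Fin.sum_two_eq _ i, priority, Fin.one_sub_one_sub, h1, h2, h3, h4,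
    Duopoly.storagePay, Duopoly.plainPay]
  rcases lt_trichotomy (P i) (P (1 - i)) with h | h | h
  · simp [h, h.le, h.not_gt]
  · rw [h]
    simp only [lt_irrefl, if_false, le_refl, if_true]
    -- If the totals agree, both orders give the same revenues and the coin is irrelevant; otherwise
    -- storage is served first.
    rcases (hM.duopoly (1 - i) hF).tie (hP (1 - i)) with ⟨h5, h6⟩ | h5
    · rw [h5, h6]
      simp only [lt_irrefl, if_false]
      constructor <;> ring
    · simp [h5, h5.not_gt]
  · simp [h, h.not_ge, h.not_gt]

lemma expectedPayoff_eq (hM : M.Admissible) (hi : φ i = true) (hj : φ (1 - i) = false)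
    (hF : ∀ x, 0 < x → 0 < M.genCDF (1 - i) x) (hmean : M.mean i = M.mean (1 - i))
    {μ : Fin 2 → Measure ℝ} (hμ : ∀ k, M.IsPriceStrategy (μ k)) :
    M.expectedPayoff φ μ i =
      ∫ z, (hM.duopoly (1 - i) hF).storagePay z.1 z.2 ∂(μ i).prod (μ (1 - i)) ∧
    M.expectedPayoff φ μ (1 - i) =
      ∫ z, (hM.duopoly (1 - i) hF).plainPay z.1 z.2 ∂(μ i).prod (μ (1 - i)) := by
  have : ∀ k, IsProbabilityMeasure (μ k) := fun k => (hμ k).1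
  have hmem : ∀ᵐ P ∂Measure.pi μ, ∀ k, P k ∈ Icc 0 M.pbar :=
    ae_all_iff.2 fun k => (measurePreserving_eval μ k).quasiMeasurePreserving.ae (hμ k).2
  rw [← integral_pi_two μ i fun z => (hM.duopoly (1 - i) hF).storagePay z.1 z.2,
    ← integral_pi_two μ i fun z => (hM.duopoly (1 - i) hF).plainPay z.1 z.2]
  exact ⟨integral_congr_ae (hmem.mono fun P hP => (hM.payoff_eq hi hj hF hmean hP).1),
    integral_congr_ae (hmem.mono fun P hP => (hM.payoff_eq hi hj hF hmean hP).2)⟩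

/-- Deviations to point masses bound every pure price's revenue by the equilibrium revenue; the
latter is the average of these revenues under the supplier's own strategy, so almost every price
attains it. -/
lemma isEquilibrium_of_mixed (hM : M.Admissible) (hi : φ i = true) (hj : φ (1 - i) = false)
    (hF : ∀ x, 0 < x → 0 < M.genCDF (1 - i) x) (hmean : M.mean i = M.mean (1 - i))
    {μ : Fin 2 → Measure ℝ} (h : M.IsMixedEquilibrium φ μ) :
    (hM.duopoly (1 - i) hF).IsEquilibrium (μ i) (μ (1 - i))
      (M.expectedPayoff φ μ i) (M.expectedPayoff φ μ (1 - i)) := by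
  have : ∀ k, IsProbabilityMeasure (μ k) := fun k => (h.1 k).1
  set G := hM.duopoly (1 - i) hF with hG
  have hne := Fin.one_sub_ne i
  have memS : ∀ᵐ q ∂μ i, q ∈ Icc 0 G.pbar := (h.1 i).2
  have memN : ∀ᵐ p ∂μ (1 - i), p ∈ Icc 0 G.pbar := (h.1 (1 - i)).2
  have hv := hM.expectedPayoff_eq hi hj hF hmean h.1
  have intS := G.integrable_storagePay_prod memS memN
  have intN := G.integrable_plainPay_prod (σ := μ i) memN
  have hup : ∀ k q, q ∈ Icc 0 M.pbar →
      ∀ l, M.IsPriceStrategy (Function.update μ k (Measure.dirac q) l) := by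
    intro k q hq l
    rcases eq_or_ne l k with rfl | hl
    · rw [Function.update_self]
      exact isPriceStrategy_dirac hq
    · rw [Function.update_of_ne hl]
      exact h.1 l
  have leS : ∀ q ∈ Icc 0 G.pbar, ∫ p, G.storagePay q p ∂μ (1 - i) ≤ M.expectedPayoff φ μ i := by
    intro q hq
    have h1 := h.2 i _ (isPriceStrategy_dirac hq)
    rw [(hM.expectedPayoff_eq hi hj hF hmean (hup i q hq)).1, Function.update_self,
      Function.update_of_ne hne, integral_prod _ (G.integrable_storagePay_prod
        (isPriceStrategy_dirac hq).2 memN), integral_dirac] at h1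
    exact h1
  have leN : ∀ p ∈ Icc 0 G.pbar,
      ∫ q, G.plainPay q p ∂μ i ≤ M.expectedPayoff φ μ (1 - i) := by
    intro p hp
    have h1 := h.2 (1 - i) _ (isPriceStrategy_dirac hp)
    rw [(hM.expectedPayoff_eq hi hj hF hmean (hup (1 - i) p hp)).2, Function.update_self,
      Function.update_of_ne hne.symm, integral_prod_symm _ (G.integrable_plainPay_prod
        (isPriceStrategy_dirac hp).2), integral_dirac] at h1
    exact h1
  refine ⟨inferInstance, inferInstance, memS, memN, leS, ?_, leN, ?_⟩
  · exact ae_eq_of_ae_le_of_integral_eq intS.integral_prod_left (memS.mono leS)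
      (hv.1.trans (integral_prod _ intS))
  · exact ae_eq_of_ae_le_of_integral_eq intN.integral_prod_right (memN.mono leN)
      (hv.2.trans (integral_prod_symm _ intN))

lemma isEquilibrium_of_pure (hM : M.Admissible) (hi : φ i = true) (hj : φ (1 - i) = false)
    (hF : ∀ x, 0 < x → 0 < M.genCDF (1 - i) x) (hmean : M.mean i = M.mean (1 - i))
    {P : Fin 2 → ℝ} (h : M.IsPureEquilibrium φ P) :
    (hM.duopoly (1 - i) hF).IsEquilibrium (Measure.dirac (P i)) (Measure.dirac (P (1 - i)))
      (M.payoff φ P i) (M.payoff φ P (1 - i)) := by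
  have hne := Fin.one_sub_ne i
  have hup : ∀ k q, q ∈ Icc 0 M.pbar → ∀ l, Function.update P k q l ∈ Icc 0 M.pbar := by
    intro k q hq l
    rcases eq_or_ne l k with rfl | hl
    · rwa [Function.update_self]
    · rw [Function.update_of_ne hl]
      exact h.1 l
  have hv := hM.payoff_eq hi hj hF hmean h.1
  refine ⟨inferInstance, inferInstance, (isPriceStrategy_dirac (h.1 _)).2,
    (isPriceStrategy_dirac (h.1 _)).2, fun q hq => ?_, ?_, fun p hp => ?_, ?_⟩
  · have h1 := h.2 i q hq
    rw [(hM.payoff_eq hi hj hF hmean (hup i q hq)).1, Function.update_self,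
      Function.update_of_ne hne] at h1
    rwa [integral_dirac]
  · simp only [integral_dirac, ae_dirac_eq, Filter.eventually_pure]
    exact hv.1.symm
  · have h1 := h.2 (1 - i) p hp
    rw [(hM.payoff_eq hi hj hF hmean (hup (1 - i) p hp)).2, Function.update_self,
      Function.update_of_ne hne.symm] at h1
    rwa [integral_dirac]
  · simp only [integral_dirac, ae_dirac_eq, Filter.eventually_pure]
    exact hv.2.symm

end Storage

end Admissible
end Market

end

theorem theorem3 {Ω : Type*} [MeasurableSpace Ω] (M : Market Ω) (hM : M.Admissible)
    (φ : Fin 2 → Bool) (i : Fin 2) (hi : φ i = true) (hj : φ (1 - i) = false)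
    (hF : ∀ x, 0 < x → 0 < M.genCDF (1 - i) x)
    (hmean : M.mean i = M.mean (1 - i))
    (v : Fin 2 → ℝ) (hv : M.IsEquilibriumRevenue φ v) :
    v (1 - i) < v i ∧
    (pdf.IsUniform (M.X (1 - i)) (Set.Icc 0 (M.Xbar (1 - i))) M.P volume →
      0 < v (1 - i) ∧
      (M.D ≤ M.mean i → 2 ≤ v i / v (1 - i)) ∧
      (M.D = M.mean i → 4 ≤ v i / v (1 - i)) ∧
      (M.mean i < M.D → M.lam / M.pbar ≤ v i / v (1 - i))) := by
  obtain ⟨σ, ν, h⟩ : ∃ σ ν, (hM.duopoly (1 - i) hF).IsEquilibrium σ ν (v i) (v (1 - i)) := by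
    rcases hv with ⟨P, hP, rfl⟩ | ⟨μ, hμ, rfl⟩
    · exact ⟨_, _, hM.isEquilibrium_of_pure hi hj hF hmean hP⟩
    · exact ⟨_, _, hM.isEquilibrium_of_mixed hi hj hF hmean hμ⟩
  refine ⟨h.plain_lt_storage, fun hU => ?_⟩
  have hy := hM.duopoly_y_uniform (1 - i) hU hF
  have hnet := hM.duopoly_net_uniform (1 - i) hU hF
  have hpos := h.plain_pos
  rw [hmean]
  refine ⟨hpos, fun hD => ?_, fun hD => ?_, fun hD => ?_⟩
  · rw [le_div_iff₀ hpos]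
    exact h.two_mul_plain_le hD hnet
  · rw [le_div_iff₀ hpos]
    exact h.four_mul_plain_le hD hy hnet
  · rw [div_le_div_iff₀ hM.cap_pos hpos, mul_comm (v i)]
    exact h.lam_mul_plain_le hD hy hnet
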